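/- Let $R$ be a commutative ring. A functor of $\mathcal R$-modules is a covariant functor $\mathbb M$ on commutative $R$-algebras with a natural $S$-module structure on each $\mathbb M(S)$; $\mathcal R$ is the functor $\mathcal R(S)=S$. Morphisms, tensor products, inverse limits and epimorphisms are taken value by value, so $(\mathbb M\otimes\mathbb N)(S)=\mathbb M(S)\otimes_S\mathbb N(S)$. The dual is $\mathbb M^*(S)=\mathrm{Hom}_{\mathcal S}(\mathbb M_{|S},\mathcal S)$, where $\mathbb M_{|S}$ is the restriction of $\mathbb M$ to commutative $S$-algebras; $\mathbb M$ is reflexive if the canonical morphism $\mathbb M\to\mathbb M^{**}$ is an isomorphism. Put $\mathbb M\tilde\otimes\mathbb N=(\mathbb M^*\otimes\mathbb N^*)^*$. $\mathbb M$ is essentially free if $\mathbb M\simeq\varprojlim_{\alpha\in P}\bigoplus_{\alpha}\mathcal R$ for a set $I$ and a set $P$ of subsets of $I$ stable under binary unions, with the restrictions $\bigoplus_\beta\mathcal R\to\bigoplus_\alpha\mathcal R$ ($\alpha\subseteq\beta$) as transition morphisms. A functor of $\mathcal R$-algebras is a functor of $\mathcal R$-modules with a natural structure of associative unital $S$-algebra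 on each value. For an $R$-algebra $A$, the quasi-coherent algebra $\mathcal A$ is $S\mapsto A\otimes_RS$. A functor of $\mathcal R$-algebras is pro-quasicoherent if it is the inverse limit of its quasi-coherent algebra quotients. If $\mathbb B$ is a reflexive functor of pro-quasicoherent algebras with quasi-coherent algebra quotients $\mathcal A_i$, then $\mathbb B\tilde\otimes\mathbb B=\varprojlim_{i,j}\mathcal A_i\otimes\mathcal A_j$ is a functor of algebras. A functor of bialgebras is a reflexive functor $\mathbb B$ of pro-quasicoherent algebras together with a structure of functor of $\mathcal R$-algebras on $\mathbb B^*$ such that the duals $\mathbb B\to\mathbb B\tilde\otimes\mathbb B$ and $\mathbb B\to\mathcal R$ of the multiplication $\mathbb B^*\otimes\mathbb B^*\to\mathbb B^*$ and of the unit $\mathcal R\to\mathbb B^*$ are morphisms of functors of $\mathcal R$-algebras. It is a functor of pro-quasicoherent bialgebras if $\mathbb B^*$ is also a functor of pro-quasicoherent algebras. A morphism $f\colon\mathbb B\to\mathbb B'$ of functors of bialgebras is a morphism of $\mathcal R$-modules such that $f$ and $f^*\colon\mathbb B'^*\to\mathbb B^*$ are morphisms of functors of $\mathcal R$-algebras.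 **Theorem.** Let $\mathcal C$ be the category of essentially free functors of pro-quasicoherent bialgebras. If $\mathbb B\in\mathcal C$, then $\mathbb B^*$, with its algebra structure and with the algebra structure of $\mathbb B$ on $\mathbb B^{**}=\mathbb B$, is again in $\mathcal C$, and the contravariant functor $\mathcal C\to\mathcal C$, $\mathbb B\mapsto\mathbb B^*$, $f\mapsto f^*$, is an anti-equivalence of categories. -/

import Mathlib

open CategoryTheory

universe u w w' w'' w₁ w₂

noncomputable section

namespace ReflexiveFunctors

open TensorProduct

/-! ## Functors of `𝓡`-modules -/

/-- The ring homomorphism underlying a morphism of commutative `R`-algebras. -/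
def rh {R : Type u} [CommRing R] {S T : CommAlgCat.{u} R} (f : S ⟶ T) : S →+* T :=
  f.hom.toRingHom

@[simp] theorem rh_apply {R : Type u} [CommRing R] {S T : CommAlgCat.{u} R} (f : S ⟶ T) (s : S) :
    rh f s = f.hom s := rfl

/-- A functor of `𝓡`-modules: a covariant functor `S ↦ M(S)` on commutative `R`-algebras, with an
`S`-module structure on each `M(S)` such that addition and scalar multiplication are natural.
The values may live in any universe `w`, because the dual of a functor is a priori large. -/
structure ModFunctor (R : Type u) [CommRing R] where
  obj : CommAlgCat.{u} R → Type w
  [grp : ∀ S : CommAlgCat.{u} R, AddCommGroup (obj S)]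
  [mod : ∀ S : CommAlgCat.{u} R, Module S (obj S)]
  map : ∀ {S T : CommAlgCat.{u} R} (f : S ⟶ T), obj S →ₛₗ[rh f] obj T
  map_id : ∀ (S : CommAlgCat.{u} R) (x : obj S), map (𝟙 S) x = x
  map_comp : ∀ {S T U : CommAlgCat.{u} R} (f : S ⟶ T) (g : T ⟶ U) (x : obj S),
    map (f ≫ g) x = map g (map f x)

attribute [instance] ModFunctor.grp ModFunctor.mod

variable {R : Type u} [CommRing R]

/-- Morphisms of functors of `𝓡`-modules. -/
@[ext]
structure Hom (M : ModFunctor.{u, w} R) (N : ModFunctor.{u, w'} R) where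
  app : ∀ S : CommAlgCat.{u} R, M.obj S →ₗ[S] N.obj S
  naturality : ∀ {S T : CommAlgCat.{u} R} (f : S ⟶ T) (x : M.obj S),
    app T (M.map f x) = N.map f (app S x)

namespace Hom

variable {M : ModFunctor.{u, w} R} {N : ModFunctor.{u, w'} R} {L : ModFunctor.{u, w''} R}

/-- The identity morphism. -/
def id (M : ModFunctor.{u, w} R) : Hom M M where
  app _ := LinearMap.id
  naturality _ _ := rfl

/-- Composition of morphisms (first `f`, then `g`). -/
def comp (f : Hom M N) (g : Hom N L) : Hom M L where
  app S := (g.app S).comp (f.app S)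
  naturality h x := by simp [f.naturality, g.naturality]

/-- An isomorphism of functors of `𝓡`-modules. -/
def IsIso (f : Hom M N) : Prop := ∀ S, Function.Bijective (f.app S)

/-- An epimorphism of functors of `𝓡`-modules (cokernels are computed value by value). -/
def IsEpi (f : Hom M N) : Prop := ∀ S, Function.Surjective (f.app S)

/-- The inverse of an isomorphism. -/
def inv (f : Hom M N) (hf : f.IsIso) : Hom N M where
  app S := (LinearEquiv.ofBijective (f.app S) (hf S)).symm.toLinearMap
  naturality {S T} h x := by
    apply (hf T).1
    obtain ⟨y, rfl⟩ := (hf S).2 x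
    have h1 : ∀ (U : CommAlgCat.{u} R) (z : N.obj U),
        f.app U ((LinearEquiv.ofBijective (f.app U) (hf U)).symm z) = z := fun U z =>
      (LinearEquiv.ofBijective (f.app U) (hf U)).apply_symm_apply z
    have h2 : (LinearEquiv.ofBijective (f.app S) (hf S)).symm (f.app S y) = y :=
      (LinearEquiv.ofBijective (f.app S) (hf S)).symm_apply_apply y
    simp only [LinearEquiv.coe_coe, h1, h2, f.naturality]

theorem app_inv (f : Hom M N) (hf : f.IsIso) (S : CommAlgCat.{u} R) (x : N.obj S) :
    f.app S ((f.inv hf).app S x) = x :=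
  (LinearEquiv.ofBijective (f.app S) (hf S)).apply_symm_apply x

theorem inv_app (f : Hom M N) (hf : f.IsIso) (S : CommAlgCat.{u} R) (x : M.obj S) :
    (f.inv hf).app S (f.app S x) = x :=
  (LinearEquiv.ofBijective (f.app S) (hf S)).symm_apply_apply x

end Hom

/-- The functor `𝓡`, with `𝓡(S) = S`. -/
def unit (R : Type u) [CommRing R] : ModFunctor.{u, u} R where
  obj S := S
  map f := { toFun := f.hom, map_add' := map_add f.hom, map_smul' := fun s x => map_mul f.hom s x }
  map_id _ _ := rfl
  map_comp _ _ _ := rfl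

/-! ## Duals -/

/-- The elements of `M^*(S) = Hom_𝓢(M|_S, 𝓢)`. A commutative `S`-algebra is given as a commutative
`R`-algebra `T` with a morphism of `R`-algebras `f : S ⟶ T`. -/
@[ext]
structure DualElt (M : ModFunctor.{u, w} R) (S : CommAlgCat.{u} R) where
  app : ∀ (T : CommAlgCat.{u} R) (_ : S ⟶ T), M.obj T →ₗ[T] T
  naturality : ∀ {T T' : CommAlgCat.{u} R} (f : S ⟶ T) (g : T ⟶ T') (x : M.obj T),
    app T' (f ≫ g) (M.map g x) = g.hom (app T f x)

namespace DualElt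

variable {M : ModFunctor.{u, w} R} {S : CommAlgCat.{u} R}

instance : Zero (DualElt M S) := ⟨⟨fun _ _ => 0, by simp⟩⟩
instance : Add (DualElt M S) :=
  ⟨fun a b => ⟨fun T f => a.app T f + b.app T f, by simp [a.naturality, b.naturality]⟩⟩
instance : Neg (DualElt M S) := ⟨fun a => ⟨fun T f => - a.app T f, by simp [a.naturality]⟩⟩
instance : SMul S (DualElt M S) :=
  ⟨fun s a => ⟨fun T f => f.hom s • a.app T f, by simp [a.naturality]⟩⟩

@[simp] theorem zero_app (T : CommAlgCat.{u} R) (f : S ⟶ T) : (0 : DualElt M S).app T f = 0 := rfl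
@[simp] theorem add_app (a b : DualElt M S) (T : CommAlgCat.{u} R) (f : S ⟶ T) :
    (a + b).app T f = a.app T f + b.app T f := rfl
@[simp] theorem neg_app (a : DualElt M S) (T : CommAlgCat.{u} R) (f : S ⟶ T) :
    (-a).app T f = - a.app T f := rfl
@[simp] theorem smul_app (s : S) (a : DualElt M S) (T : CommAlgCat.{u} R) (f : S ⟶ T) :
    (s • a).app T f = f.hom s • a.app T f := rfl

theorem ext' {a b : DualElt M S}
    (h : ∀ (T : CommAlgCat.{u} R) (f : S ⟶ T) (x : M.obj T), a.app T f x = b.app T f x) :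
    a = b := by
  ext T f x
  exact h T f x

instance : AddCommGroup (DualElt M S) where
  add_assoc a b c := ext' fun T f x => by simp [add_assoc]
  zero_add a := ext' fun T f x => by simp
  add_zero a := ext' fun T f x => by simp
  add_comm a b := ext' fun T f x => by simp [add_comm]
  neg_add_cancel a := ext' fun T f x => by simp
  nsmul := nsmulRec
  zsmul := zsmulRec

instance : Module S (DualElt M S) where
  one_smul a := ext' fun T f x => by simp
  mul_smul s t a := ext' fun T f x => by simp [mul_assoc]
  smul_zero s := ext' fun T f x => by simp
  smul_add s a b := ext' fun T f x => by simp
  add_smul s t a := ext' fun T f x => by simp [add_mul]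
  zero_smul a := ext' fun T f x => by simp

end DualElt

/-- The dual functor `M^* = Hom_𝓡(M, 𝓡)`. -/
def dual (M : ModFunctor.{u, w} R) : ModFunctor.{u, max w (u + 1)} R where
  obj S := DualElt M S
  map h :=
    { toFun := fun a => ⟨fun T f => a.app T (h ≫ f), fun f g x => by
        rw [← Category.assoc]; exact a.naturality (h ≫ f) g x⟩
      map_add' := fun _ _ => rfl
      map_smul' := fun _ _ => rfl }
  map_id S a := DualElt.ext' fun T f x => by
    change a.app T (𝟙 S ≫ f) x = a.app T f x
    rw [Category.id_comp]
  map_comp h h' a := DualElt.ext' fun T f x => by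
    change a.app T ((h ≫ h') ≫ f) x = a.app T (h ≫ h' ≫ f) x
    rw [Category.assoc]

/-- The dual (transpose) `f^* : N^* → M^*` of a morphism `f : M → N`. -/
def Hom.dual {M : ModFunctor.{u, w} R} {N : ModFunctor.{u, w'} R} (f : Hom M N) :
    Hom (dual N) (dual M) where
  app S :=
    { toFun := fun (a : DualElt N S) =>
        (⟨fun T g => (a.app T g).comp (f.app T), fun g h x => by
          simp [f.naturality, a.naturality]⟩ : DualElt M S)
      map_add' := fun _ _ => rfl
      map_smul' := fun _ _ => rfl }
  naturality _ _ := rfl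

/-- The canonical morphism `M → M^**`. -/
def ev (M : ModFunctor.{u, w} R) : Hom M (dual (dual M)) where
  app S :=
    { toFun := fun x =>
        (⟨fun T f =>
          { toFun := fun (a : DualElt M T) => a.app T (𝟙 T) (M.map f x)
            map_add' := fun _ _ => rfl
            map_smul' := fun _ _ => rfl }, fun {T T'} f g (a : DualElt M T) => by
            change a.app T' (g ≫ 𝟙 T') (M.map (f ≫ g) x) = g.hom (a.app T (𝟙 T) (M.map f x))
            rw [← a.naturality, M.map_comp, Category.comp_id, Category.id_comp]⟩ :
          DualElt (dual M) S)
      map_add' := fun x y => DualElt.ext' fun T f a => by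
        change DualElt.app a T (𝟙 T) (M.map f (x + y)) = DualElt.app a T (𝟙 T) (M.map f x) +
          DualElt.app a T (𝟙 T) (M.map f y)
        rw [map_add, map_add]
      map_smul' := fun s x => DualElt.ext' fun T f a => by
        change DualElt.app a T (𝟙 T) (M.map f (s • x)) =
          f.hom s • DualElt.app a T (𝟙 T) (M.map f x)
        rw [LinearMap.map_smulₛₗ, LinearMap.map_smul]
        rfl }
  naturality h x := DualElt.ext' fun T f a => by
    change DualElt.app a T (𝟙 T) (M.map f (M.map h x)) = DualElt.app a T (𝟙 T) (M.map (h ≫ f) x)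
    rw [M.map_comp]

/-- `M` is reflexive: the canonical morphism `M → M^**` is an isomorphism. -/
def IsReflexive (M : ModFunctor.{u, w} R) : Prop := (ev M).IsIso

theorem ev_dual_comp (M : ModFunctor.{u, w} R) (S : CommAlgCat.{u} R) (a : (dual M).obj S) :
    (ev M).dual.app S ((ev (dual M)).app S a) = a :=
  DualElt.ext' fun T f x => by
    change DualElt.app a T (f ≫ 𝟙 T) (M.map (𝟙 T) x) = DualElt.app a T f x
    rw [M.map_id, Category.comp_id]

theorem ev_naturality {M : ModFunctor.{u, w} R} {N : ModFunctor.{u, w'} R} (f : Hom M N)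
    (S : CommAlgCat.{u} R) (x : M.obj S) :
    f.dual.dual.app S ((ev M).app S x) = (ev N).app S (f.app S x) :=
  DualElt.ext' fun T g a => by
    change DualElt.app a T (𝟙 T) (f.app T (M.map g x)) =
      DualElt.app a T (𝟙 T) (N.map g (f.app S x))
    rw [f.naturality]

theorem Hom.IsIso.dual {M : ModFunctor.{u, w} R} {N : ModFunctor.{u, w'} R} {f : Hom M N}
    (hf : f.IsIso) : f.dual.IsIso := fun S => by
  constructor
  · intro a b hab
    refine DualElt.ext' fun T g x => ?_
    obtain ⟨y, rfl⟩ := (hf T).2 x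
    exact LinearMap.congr_fun (congrFun (congrFun (congrArg DualElt.app hab) T) g) y
  · intro a
    refine ⟨(f.inv hf).dual.app S a, DualElt.ext' fun T g x => ?_⟩
    change DualElt.app a T g ((f.inv hf).app T (f.app T x)) = DualElt.app a T g x
    rw [f.inv_app]

theorem IsReflexive.dual {M : ModFunctor.{u, w} R} (h : IsReflexive M) :
    IsReflexive (dual M) := fun S => by
  have hd := Hom.IsIso.dual h S
  constructor
  · intro a b hab
    rw [← ev_dual_comp M S a, hab, ev_dual_comp]
  · intro b
    exact ⟨(ev M).dual.app S b, hd.1 (ev_dual_comp M S _)⟩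

/-! ## Tensor products -/

/-- The tensor product, `(M ⊗ N)(S) = M(S) ⊗_S N(S)`. -/
def tensor (M : ModFunctor.{u, w} R) (N : ModFunctor.{u, w'} R) :
    ModFunctor.{u, max w w'} R where
  obj S := M.obj S ⊗[S] N.obj S
  map f := TensorProduct.map (M.map f) (N.map f)
  map_id S x := by
    induction x with
    | zero => simp
    | tmul a b => simp [M.map_id, N.map_id]
    | add a b ha hb => rw [map_add, ha, hb]
  map_comp f g x := by
    induction x with
    | zero => simp
    | tmul a b => simp [M.map_comp, N.map_comp]
    | add a b ha hb => rw [map_add, ha, hb, map_add, map_add]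

/-- The tensor product of two morphisms. -/
def Hom.tensor {M : ModFunctor.{u, w} R} {N : ModFunctor.{u, w'} R} {M' : ModFunctor.{u, w₁} R}
    {N' : ModFunctor.{u, w₂} R} (f : Hom M M') (g : Hom N N') :
    Hom (tensor M N) (tensor M' N') where
  app S := TensorProduct.map (f.app S) (g.app S)
  naturality {S T} h := fun (x : M.obj S ⊗[S] N.obj S) => by
    change TensorProduct.map (f.app T) (g.app T) (TensorProduct.map (M.map h) (N.map h) x) =
      TensorProduct.map (M'.map h) (N'.map h) (TensorProduct.map (f.app S) (g.app S) x)
    induction x with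
    | zero => simp
    | tmul a b => simp [f.naturality, g.naturality]
    | add a b ha hb => simp only [map_add, ha, hb]

/-- `M ⊗~ N = (M^* ⊗ N^*)^*`. -/
def tilde (M : ModFunctor.{u, w} R) (N : ModFunctor.{u, w'} R) :
    ModFunctor.{u, max w w' (u + 1)} R :=
  dual (tensor (dual M) (dual N))

/-- The morphism `f ⊗~ g` induced by two morphisms. -/
def Hom.tilde {M : ModFunctor.{u, w} R} {N : ModFunctor.{u, w'} R} {M' : ModFunctor.{u, w₁} R}
    {N' : ModFunctor.{u, w₂} R} (f : Hom M M') (g : Hom N N') :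
    Hom (tilde M N) (tilde M' N') :=
  (f.dual.tensor g.dual).dual

/-- Evaluation of elements of `M^*(T)` on elements of `M(T)`, as a bilinear map. -/
def pairing (M : ModFunctor.{u, w} R) (T : CommAlgCat.{u} R) :
    M.obj T →ₗ[T] (dual M).obj T →ₗ[T] T :=
  LinearMap.mk₂ T (fun x (a : DualElt M T) => a.app T (𝟙 T) x)
    (fun x y a => map_add (DualElt.app a T (𝟙 T)) x y)
    (fun t x a => map_smul (DualElt.app a T (𝟙 T)) t x)
    (fun _ _ _ => rfl) (fun _ _ _ => rfl)

theorem pairing_map (M : ModFunctor.{u, w} R) {T T' : CommAlgCat.{u} R} (g : T ⟶ T')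
    (x : M.obj T) (a : DualElt M T) :
    pairing M T' (M.map g x) ((dual M).map g a) = g.hom (pairing M T x a) := by
  change a.app T' (g ≫ 𝟙 T') (M.map g x) = g.hom (a.app T (𝟙 T) x)
  rw [← a.naturality, Category.comp_id, Category.id_comp]

/-- The bilinear map `M(T) × N(T) → Hom_T(M^*(T) ⊗ N^*(T), T)`,
`(x, y) ↦ (a ⊗ b ↦ a(x) b(y))`. -/
def pairing₂ (M : ModFunctor.{u, w} R) (N : ModFunctor.{u, w'} R) (T : CommAlgCat.{u} R) :
    M.obj T ⊗[T] N.obj T →ₗ[T] (dual M).obj T ⊗[T] (dual N).obj T →ₗ[T] T :=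
  (LinearMap.compr₂ (TensorProduct.map₂ (pairing M T) (pairing N T))
    (LinearMap.mul' T T))

theorem pairing₂_tmul (M : ModFunctor.{u, w} R) (N : ModFunctor.{u, w'} R)
    (T : CommAlgCat.{u} R) (x : M.obj T) (y : N.obj T) (a : (dual M).obj T)
    (b : (dual N).obj T) :
    pairing₂ M N T (x ⊗ₜ y) (a ⊗ₜ b) = pairing M T x a * pairing N T y b := rfl

theorem pairing₂_map (M : ModFunctor.{u, w} R) (N : ModFunctor.{u, w'} R)
    {T T' : CommAlgCat.{u} R} (g : T ⟶ T')
    (z : M.obj T ⊗[T] N.obj T) (c : (dual M).obj T ⊗[T] (dual N).obj T) :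
    pairing₂ M N T' ((tensor M N).map g z) ((tensor (dual M) (dual N)).map g c) =
      g.hom (pairing₂ M N T z c) := by
  change pairing₂ M N T' (TensorProduct.map (M.map g) (N.map g) z)
    (TensorProduct.map ((dual M).map g) ((dual N).map g) c) = _
  induction z with
  | zero => simp
  | add z z' hz hz' => simp only [map_add, LinearMap.add_apply, hz, hz']
  | tmul x y =>
    induction c with
    | zero => simp
    | add c c' hc hc' => simp only [map_add, hc, hc']
    | tmul a b =>
      simp only [TensorProduct.map_tmul, pairing₂_tmul, map_mul]
      exact congrArg₂ (· * ·) (pairing_map M g x a) (pairing_map N g y b)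

/-- The natural morphism `M ⊗ N → M ⊗~ N`. -/
def toTilde (M : ModFunctor.{u, w} R) (N : ModFunctor.{u, w'} R) :
    Hom (tensor M N) (tilde M N) where
  app S :=
    { toFun := fun z => (⟨fun T f => pairing₂ M N T ((tensor M N).map f z), fun f g c => by
          rw [(tensor M N).map_comp]; exact pairing₂_map M N g _ c⟩ :
          DualElt (tensor (dual M) (dual N)) S)
      map_add' := fun z z' => DualElt.ext' fun T f c => by
        change pairing₂ M N T ((tensor M N).map f (z + z')) c =
          pairing₂ M N T ((tensor M N).map f z) c + pairing₂ M N T ((tensor M N).map f z') c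
        rw [map_add]
        exact LinearMap.congr_fun (map_add (pairing₂ M N T) _ _) c
      map_smul' := fun s z => DualElt.ext' fun T f c => by
        change pairing₂ M N T ((tensor M N).map f (s • z)) c =
          f.hom s • pairing₂ M N T ((tensor M N).map f z) c
        rw [LinearMap.map_smulₛₗ]
        exact LinearMap.congr_fun (map_smul (pairing₂ M N T) _ _) c }
  naturality {S T} h z := DualElt.ext' fun U f c => by
    change pairing₂ M N U ((tensor M N).map f ((tensor M N).map h z)) c =
      pairing₂ M N U ((tensor M N).map (h ≫ f) z) c
    rw [(tensor M N).map_comp]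

/-! ## Essentially free functors -/

/-- The values of `lim_{α ∈ P} 𝓡^(α)`, where `𝓡^(α) = ⨁_α 𝓡` and the transition morphism
`𝓡^(β) → 𝓡^(α)`, for `α ⊆ β`, is the restriction of families to `α`. -/
def limFreeObj {I : Type u} (P : Set (Set I)) (S : CommAlgCat.{u} R) :
    Submodule S (∀ α : P, (α.1 →₀ S)) where
  carrier := {x | ∀ (α β : P) (h : α.1 ⊆ β.1) (i : α.1), x β ⟨i.1, h i.2⟩ = x α i}
  add_mem' hx hy α β h i := by simp [hx α β h i, hy α β h i]
  zero_mem' α β h i := by simp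
  smul_mem' s x hx α β h i := by simp [hx α β h i]

/-- The functor of `𝓡`-modules `lim_{α ∈ P} 𝓡^(α)`. -/
def limFree (R : Type u) [CommRing R] {I : Type u} (P : Set (Set I)) : ModFunctor.{u, u} R where
  obj S := limFreeObj P S
  map f :=
    { toFun := fun x => ⟨fun α => (x.1 α).mapRange f.hom (map_zero _), fun α β h i => by
        simp [x.2 α β h i]⟩
      map_add' := fun x y => Subtype.ext <| funext fun α => Finsupp.ext fun i => by simp
      map_smul' := fun s x => Subtype.ext <| funext fun α => Finsupp.ext fun i => by simp }
  map_id S x := Subtype.ext <| funext fun α => Finsupp.ext fun i => by simp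
  map_comp f g x := Subtype.ext <| funext fun α => Finsupp.ext fun i => by simp

/-- `M` is essentially free: it is isomorphic to `lim_{α ∈ P} 𝓡^(α)` for some set `P` of subsets of
a set `I` that is stable under binary unions. -/
def IsEssentiallyFree (M : ModFunctor.{u, w} R) : Prop :=
  ∃ (I : Type u) (P : Set (Set I)) (_ : ∀ α ∈ P, ∀ β ∈ P, α ∪ β ∈ P) (e : Hom M (limFree R P)),
    e.IsIso

/-! ## Functors of `𝓡`-algebras -/

/-- A structure of functor of `𝓡`-algebras (associative, with unit, not necessarily commutative) on
a functor of `𝓡`-modules. -/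
structure AlgStruct (M : ModFunctor.{u, w} R) where
  mul : ∀ S : CommAlgCat.{u} R, M.obj S →ₗ[S] M.obj S →ₗ[S] M.obj S
  one : ∀ S : CommAlgCat.{u} R, M.obj S
  mul_assoc : ∀ (S : CommAlgCat.{u} R) (x y z : M.obj S),
    mul S (mul S x y) z = mul S x (mul S y z)
  one_mul : ∀ (S : CommAlgCat.{u} R) (x : M.obj S), mul S (one S) x = x
  mul_one : ∀ (S : CommAlgCat.{u} R) (x : M.obj S), mul S x (one S) = x
  map_mul : ∀ {S T : CommAlgCat.{u} R} (f : S ⟶ T) (x y : M.obj S),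
    M.map f (mul S x y) = mul T (M.map f x) (M.map f y)
  map_one : ∀ {S T : CommAlgCat.{u} R} (f : S ⟶ T), M.map f (one S) = one T

/-- A morphism of functors of modules is a morphism of functors of `𝓡`-algebras. -/
def IsAlgHom {M : ModFunctor.{u, w} R} {N : ModFunctor.{u, w'} R} (a : AlgStruct M)
    (b : AlgStruct N) (f : Hom M N) : Prop :=
  (∀ (S : CommAlgCat.{u} R) (x y : M.obj S),
    f.app S (a.mul S x y) = b.mul S (f.app S x) (f.app S y)) ∧
  ∀ S : CommAlgCat.{u} R, f.app S (a.one S) = b.one S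

section

variable {S : Type u} [CommRing S] {A : Type w} {B : Type w'} [AddCommGroup A] [AddCommGroup B]
  [Module S A] [Module S B] {m : A →ₗ[S] A →ₗ[S] A} {n : B →ₗ[S] B →ₗ[S] B}

theorem map₂_assoc (hm : ∀ x y z, m (m x y) z = m x (m y z))
    (hn : ∀ x y z, n (n x y) z = n x (n y z)) (x y z : A ⊗[S] B) :
    map₂ m n (map₂ m n x y) z = map₂ m n x (map₂ m n y z) := by
  induction x with
  | zero => simp
  | add x x' hx hx' => simp only [map_add, LinearMap.add_apply, hx, hx']
  | tmul x x' =>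
    induction y with
    | zero => simp
    | add y y' hy hy' => simp only [map_add, LinearMap.add_apply, hy, hy']
    | tmul y y' =>
      induction z with
      | zero => simp
      | add z z' hz hz' => simp only [map_add, hz, hz']
      | tmul z z' => simp [map₂_apply_tmul, hm, hn]

theorem map₂_one_mul {e : A} {e' : B} (hm : ∀ x, m e x = x) (hn : ∀ x, n e' x = x)
    (x : A ⊗[S] B) : map₂ m n (e ⊗ₜ e') x = x := by
  induction x with
  | zero => simp
  | add x x' hx hx' => simp only [map_add, hx, hx']
  | tmul x x' => simp [map₂_apply_tmul, hm, hn]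

theorem map₂_mul_one {e : A} {e' : B} (hm : ∀ x, m x e = x) (hn : ∀ x, n x e' = x)
    (x : A ⊗[S] B) : map₂ m n x (e ⊗ₜ e') = x := by
  induction x with
  | zero => simp
  | add x x' hx hx' => simp only [map_add, LinearMap.add_apply, hx, hx']
  | tmul x x' => simp [map₂_apply_tmul, hm, hn]

end

namespace AlgStruct

variable {M : ModFunctor.{u, w} R} {N : ModFunctor.{u, w'} R}

/-- The multiplication morphism `M ⊗ M → M`. -/
def mulHom (a : AlgStruct M) : Hom (tensor M M) M where
  app S := TensorProduct.lift (a.mul S)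
  naturality {S T} f := fun (x : M.obj S ⊗[S] M.obj S) => by
    change TensorProduct.lift (a.mul T) (TensorProduct.map (M.map f) (M.map f) x) =
      M.map f (TensorProduct.lift (a.mul S) x)
    induction x with
    | zero => simp
    | tmul x y => simp [a.map_mul]
    | add x y hx hy => simp only [map_add, hx, hy]

/-- The unit morphism `𝓡 → M`. -/
def unitHom (a : AlgStruct M) : Hom (unit R) M where
  app S := LinearMap.toSpanSingleton S (M.obj S) (a.one S)
  naturality {S T} f := fun (x : S) => by
    change f.hom x • a.one T = M.map f (x • a.one S)
    rw [LinearMap.map_smulₛₗ, a.map_one]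
    rfl

/-- The algebra structure of `𝓡`. -/
def ofUnit (R : Type u) [CommRing R] : AlgStruct (unit R) where
  mul S := LinearMap.mul S S
  one S := (1 : S)
  mul_assoc S x y z := _root_.mul_assoc (G := S) x y z
  one_mul S x := _root_.one_mul (M := S) x
  mul_one S x := _root_.mul_one (M := S) x
  map_mul {S _} f := fun (x y : S) => _root_.map_mul f.hom x y
  map_one f := _root_.map_one f.hom

/-- The algebra structure of a tensor product, `(x ⊗ y)(x' ⊗ y') = xx' ⊗ yy'`. -/
def tensor (a : AlgStruct M) (b : AlgStruct N) : AlgStruct (tensor M N) where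
  mul S := TensorProduct.map₂ (a.mul S) (b.mul S)
  one S := a.one S ⊗ₜ b.one S
  mul_assoc S x y z := map₂_assoc (a.mul_assoc S) (b.mul_assoc S) x y z
  one_mul S x := map₂_one_mul (a.one_mul S) (b.one_mul S) x
  mul_one S x := map₂_mul_one (a.mul_one S) (b.mul_one S) x
  map_mul {S T} f := fun (x y : M.obj S ⊗[S] N.obj S) => by
    change TensorProduct.map (M.map f) (N.map f) (TensorProduct.map₂ (a.mul S) (b.mul S) x y) =
      TensorProduct.map₂ (a.mul T) (b.mul T) (TensorProduct.map (M.map f) (N.map f) x)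
        (TensorProduct.map (M.map f) (N.map f) y)
    induction x with
    | zero => simp
    | add x x' hx hx' => simp only [map_add, LinearMap.add_apply, hx, hx']
    | tmul x x' =>
      induction y with
      | zero => simp
      | add y y' hy hy' => simp only [map_add, hy, hy']
      | tmul y y' => simp [TensorProduct.map₂_apply_tmul, a.map_mul, b.map_mul]
  map_one {S T} f := by
    change TensorProduct.map (M.map f) (N.map f) (a.one S ⊗ₜ b.one S) = _
    simp [a.map_one, b.map_one]

/-- Transport of an algebra structure along an isomorphism of functors of modules. -/
def transport (a : AlgStruct M) (e : Hom M N) (he : e.IsIso) : AlgStruct N where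
  mul S := ((a.mul S).compl₁₂ ((e.inv he).app S) ((e.inv he).app S)).compr₂ (e.app S)
  one S := e.app S (a.one S)
  mul_assoc S x y z := by simp [e.inv_app, a.mul_assoc]
  one_mul S x := by simp [e.inv_app, e.app_inv, a.one_mul]
  mul_one S x := by simp [e.inv_app, e.app_inv, a.mul_one]
  map_mul f x y := by simp [← e.naturality, ← (e.inv he).naturality, a.map_mul]
  map_one f := by simp [← e.naturality, a.map_one]

theorem isAlgHom_transport (a : AlgStruct M) (e : Hom M N) (he : e.IsIso) :
    IsAlgHom a (a.transport e he) e :=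
  ⟨fun S x y => by simp [transport, e.inv_app], fun _ => rfl⟩

end AlgStruct

/-! ## Quasi-coherent algebras and pro-quasicoherent algebras -/

/-- The quasi-coherent module associated with an `R`-module `A`, `S ↦ S ⊗_R A`. -/
def qc (R : Type u) [CommRing R] (A : Type u) [AddCommGroup A] [Module R A] :
    ModFunctor.{u, u} R where
  obj S := S ⊗[R] A
  map {S T} f :=
    { toFun := f.hom.toLinearMap.rTensor A
      map_add' := map_add _
      map_smul' := fun s x => by
        induction x with
        | zero => simp
        | tmul t a => simp [TensorProduct.smul_tmul']
        | add x y hx hy => rw [smul_add, map_add, hx, hy, map_add, smul_add] }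
  map_id S x := by
    change (AlgHom.id R S).toLinearMap.rTensor A x = x
    rw [AlgHom.toLinearMap_id, LinearMap.rTensor_id, LinearMap.id_apply]
  map_comp f g x := by
    change (g.hom.comp f.hom).toLinearMap.rTensor A x =
      g.hom.toLinearMap.rTensor A (f.hom.toLinearMap.rTensor A x)
    rw [AlgHom.comp_toLinearMap, LinearMap.rTensor_comp_apply]

/-- The structure of functor of `𝓡`-algebras of the quasi-coherent algebra `S ↦ S ⊗_R A` associated
with an `R`-algebra `A`. -/
def qcAlg (R : Type u) [CommRing R] (A : Type u) [Ring A] [Algebra R A] :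
    AlgStruct (qc R A) where
  mul S := LinearMap.mul S (S ⊗[R] A)
  one S := (1 : S ⊗[R] A)
  mul_assoc S x y z := mul_assoc (G := S ⊗[R] A) x y z
  one_mul S x := one_mul (M := S ⊗[R] A) x
  mul_one S x := mul_one (M := S ⊗[R] A) x
  map_mul {S _} f := fun (x y : S ⊗[R] A) =>
    map_mul (Algebra.TensorProduct.map f.hom (AlgHom.id R A)) x y
  map_one f := map_one (Algebra.TensorProduct.map f.hom (AlgHom.id R A))

/-- The morphism of quasi-coherent modules induced by a linear map. -/
def qcMap {A : Type u} [AddCommGroup A] [Module R A] {A' : Type u} [AddCommGroup A'] [Module R A']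
    (h : A →ₗ[R] A') : Hom (qc R A) (qc R A') where
  app S := h.baseChange S
  naturality {S T} f := fun (x : S ⊗[R] A) => by
    change h.lTensor T (f.hom.toLinearMap.rTensor A x) =
      f.hom.toLinearMap.rTensor A' (h.lTensor S x)
    rw [← LinearMap.comp_apply, ← LinearMap.comp_apply, LinearMap.lTensor_comp_rTensor,
      LinearMap.rTensor_comp_lTensor]

/-- A quasi-coherent algebra quotient of a functor of `𝓡`-algebras: an epimorphism of functors of
`𝓡`-algebras onto a quasi-coherent algebra. -/
structure QCQuotient {M : ModFunctor.{u, w} R} (a : AlgStruct M) where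
  alg : Type u
  [ring : Ring alg]
  [algebra : Algebra R alg]
  proj : Hom M (qc R alg)
  isAlgHom : IsAlgHom a (qcAlg R alg) proj
  isEpi : proj.IsEpi

attribute [instance] QCQuotient.ring QCQuotient.algebra

/-- A functor of pro-quasicoherent algebras: it is the inverse limit of its quasi-coherent algebra
quotients. The transition morphisms are the morphisms of algebras that commute with the projections;
the condition says that every compatible family of elements of the quotients comes from exactly one
element. -/
def IsProQuasicoherent {M : ModFunctor.{u, w} R} (a : AlgStruct M) : Prop :=
  ∀ (S : CommAlgCat.{u} R) (x : ∀ Q : QCQuotient a, (qc R Q.alg).obj S),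
    (∀ (Q Q' : QCQuotient a) (h : Q.alg →ₐ[R] Q'.alg),
      Q.proj.comp (qcMap h.toLinearMap) = Q'.proj → (qcMap h.toLinearMap).app S (x Q) = x Q') →
    ∃! b : M.obj S, ∀ Q : QCQuotient a, Q.proj.app S b = x Q

/-! ## Functors of bialgebras -/

/-- Let `b` be a structure of functor of pro-quasicoherent algebras on `B`, with quasi-coherent
algebra quotients `𝓐_i`. The canonical morphisms `𝓐_i ⊗ 𝓐_j → 𝓐_i ⊗~ 𝓐_j` and
`B ⊗~ B → lim_{i,j} 𝓐_i ⊗~ 𝓐_j` are isomorphisms, and `B ⊗~ B = lim_{i,j} 𝓐_i ⊗ 𝓐_j` has the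
algebra structure of this inverse limit of functors of algebras. So a morphism of modules
`f : C → B ⊗~ B` is a morphism of functors of algebras if and only if all its components
`C → 𝓐_i ⊗ 𝓐_j` are. -/
def IsAlgHomToTilde {C : ModFunctor.{u, w} R} {B : ModFunctor.{u, w'} R} (c : AlgStruct C)
    (b : AlgStruct B) (f : Hom C (tilde B B)) : Prop :=
  ∀ Q Q' : QCQuotient b, ∃ g : Hom C (tensor (qc R Q.alg) (qc R Q'.alg)),
    IsAlgHom c ((qcAlg R Q.alg).tensor (qcAlg R Q'.alg)) g ∧
    g.comp (toTilde (qc R Q.alg) (qc R Q'.alg)) = f.comp (Q.proj.tilde Q'.proj)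

/-- The identification `𝓡^* = 𝓡`, `w ↦ w(1)`. -/
def dualUnit (R : Type u) [CommRing R] : Hom (dual (unit R)) (unit R) where
  app S :=
    { toFun := fun (a : DualElt (unit R) S) => a.app S (𝟙 S) (1 : S)
      map_add' := fun _ _ => rfl
      map_smul' := fun _ _ => rfl }
  naturality {S T} f := fun (a : DualElt (unit R) S) => by
    change a.app T (f ≫ 𝟙 T) (1 : T) = f.hom (a.app S (𝟙 S) (1 : S))
    have h := a.naturality (𝟙 S) f (1 : S)
    rw [Category.id_comp] at h
    rw [Category.comp_id]
    exact (congrArg (a.app T f) (map_one f.hom).symm).trans h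

/-- The dual `B = B^** → (B^* ⊗ B^*)^* = B ⊗~ B` of the multiplication of `B^*`. -/
def comul {B : ModFunctor.{u, w} R} (d : AlgStruct (dual B)) : Hom B (tilde B B) :=
  (ev B).comp d.mulHom.dual

/-- The dual `B = B^** → 𝓡^* = 𝓡` of the unit of `B^*`. -/
def counit {B : ModFunctor.{u, w} R} (d : AlgStruct (dual B)) : Hom B (unit R) :=
  ((ev B).comp d.unitHom.dual).comp (dualUnit R)

/-- A reflexive functor of `𝓡`-modules `B`, with structures of functor of `𝓡`-algebras on `B` and on
`B^*` (no compatibility yet). -/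
structure BiAlgFunctor (R : Type u) [CommRing R] where
  carrier : ModFunctor.{u, u + 1} R
  reflexive : IsReflexive carrier
  alg : AlgStruct carrier
  dualAlg : AlgStruct (dual carrier)

namespace BiAlgFunctor

/-- A morphism `f : B → B'` such that `f` and `f^* : B'^* → B^*` are morphisms of functors of
`𝓡`-algebras. -/
@[ext]
structure Hom (B B' : BiAlgFunctor R) where
  hom : ReflexiveFunctors.Hom B.carrier B'.carrier
  isAlgHom : IsAlgHom B.alg B'.alg hom
  dual_isAlgHom : IsAlgHom B'.dualAlg B.dualAlg hom.dual

instance : Category (BiAlgFunctor R) where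
  Hom B B' := Hom B B'
  id B := ⟨ReflexiveFunctors.Hom.id B.carrier, ⟨fun _ _ _ => rfl, fun _ => rfl⟩,
    ⟨fun _ _ _ => rfl, fun _ => rfl⟩⟩
  comp f g := ⟨f.hom.comp g.hom,
    ⟨fun S x y => (congrArg (g.hom.app S) (f.isAlgHom.1 S x y)).trans (g.isAlgHom.1 S _ _),
      fun S => (congrArg (g.hom.app S) (f.isAlgHom.2 S)).trans (g.isAlgHom.2 S)⟩,
    ⟨fun S x y => (congrArg (f.hom.dual.app S) (g.dual_isAlgHom.1 S x y)).trans
        (f.dual_isAlgHom.1 S _ _),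
      fun S => (congrArg (f.hom.dual.app S) (g.dual_isAlgHom.2 S)).trans (f.dual_isAlgHom.2 S)⟩⟩

/-- `B^*`, with its structure of functor of algebras and with the one of `B` on `B^** = B`. -/
def dual (B : BiAlgFunctor R) : BiAlgFunctor R where
  carrier := ReflexiveFunctors.dual B.carrier
  reflexive := B.reflexive.dual
  alg := B.dualAlg
  dualAlg := B.alg.transport (ev B.carrier) B.reflexive

/-- The functor `B ↦ B^*`, `f ↦ f^*`. -/
def dualFunctor (R : Type u) [CommRing R] : (BiAlgFunctor R)ᵒᵖ ⥤ BiAlgFunctor R where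
  obj B := B.unop.dual
  map {B B'} f := ⟨f.unop.hom.dual, f.unop.dual_isAlgHom, by
    constructor
    · intro S x y
      obtain ⟨x, rfl⟩ := (B'.unop.reflexive S).2 x
      obtain ⟨y, rfl⟩ := (B'.unop.reflexive S).2 y
      have h := AlgStruct.isAlgHom_transport B'.unop.alg (ev _) B'.unop.reflexive
      have h' := AlgStruct.isAlgHom_transport B.unop.alg (ev _) B.unop.reflexive
      change f.unop.hom.dual.dual.app S ((B'.unop.alg.transport (ev _) B'.unop.reflexive).mul S
        _ _) = (B.unop.alg.transport (ev _) B.unop.reflexive).mul S _ _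
      rw [← h.1, ev_naturality, f.unop.isAlgHom.1, h'.1]
      exact congrArg₂ (fun x y => (B.unop.alg.transport (ev _) B.unop.reflexive).mul S x y)
        (ev_naturality _ S x).symm (ev_naturality _ S y).symm
    · intro S
      have h := AlgStruct.isAlgHom_transport B'.unop.alg (ev _) B'.unop.reflexive
      have h' := AlgStruct.isAlgHom_transport B.unop.alg (ev _) B.unop.reflexive
      change f.unop.hom.dual.dual.app S ((B'.unop.alg.transport (ev _) B'.unop.reflexive).one S)
        = (B.unop.alg.transport (ev _) B.unop.reflexive).one S
      rw [← h.2, ev_naturality, f.unop.isAlgHom.2, h'.2]⟩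
  map_id _ := rfl
  map_comp _ _ := rfl

/-- `B` is a functor of bialgebras: `B` is a functor of pro-quasicoherent algebras, and the dual
morphisms of the multiplication and of the unit of `B^*` are morphisms of functors of algebras. -/
structure IsBialgebra (B : BiAlgFunctor R) : Prop where
  proqc : IsProQuasicoherent B.alg
  comul_isAlgHom : IsAlgHomToTilde B.alg B.alg (comul B.dualAlg)
  counit_isAlgHom : IsAlgHom B.alg (AlgStruct.ofUnit R) (counit B.dualAlg)

/-- `B` is an essentially free functor of pro-quasicoherent bialgebras: moreover, `B^*` is a functor
of pro-quasicoherent algebras. -/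
structure IsFBialg (B : BiAlgFunctor R) : Prop extends IsBialgebra B where
  essentiallyFree : IsEssentiallyFree B.carrier
  dual_proqc : IsProQuasicoherent B.dualAlg

/-- The objects of the category of essentially free functors of pro-quasicoherent bialgebras; the
category is the full subcategory that they span. -/
def fBialg (R : Type u) [CommRing R] : ObjectProperty (BiAlgFunctor R) := fun B => IsFBialg B

end BiAlgFunctor

end ReflexiveFunctors

end

noncomputable section

namespace ReflexiveFunctors

open TensorProduct

/-! ## Universal linear maps into commutative algebras -/

section Universal

variable (S : Type u) [CommRing S]

/-! Reflexivity makes the duality formal: `ev` is an isomorphism of bialgebra functors from `B` to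
its double dual, which gives essential surjectivity, and transposition makes the dual functor full
and faithful. The substance is that the dual of an object is again an object. Pro-quasicoherence of
both algebras is part of the data, up to transport along `ev`; two points remain.

Essential freeness. For `P` stable under unions, the values of `limFree R P` are the functions on
`I` whose support lies in `⋃₀ P` and meets each member of `P` in a finite set, that is, lies in
`dualFamily P`. Evaluating a functional at a universal point shows that it is a finite combination
of coordinates on each member of `dualFamily P`; hence the dual is `limFree R (dualFamily P)`
(`dualLimFree_isIso`).

Bialgebra axioms. The counit of the dual is evaluation at `1`, and `comul_one` makes it
multiplicative. For the comultiplication one needs `⟨xy, φψ⟩ = ⟨g(φ)g(ψ), a ⊗ a'⟩`, where `x`, `y`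
are the transposes of functionals `a`, `a'` on quotients of the dual and `g` is the corresponding
component of the comultiplication. As functions of `(φ, ψ)` both sides are elements of `B ⊗~ B`.
Functionals coming from quasi-coherent quotients of `B` are dense (`tilde_ext`), so `φ`, `ψ` may be
taken of this kind. Everything then happens between quasi-coherent modules, where `toTilde` is an
isomorphism (`toTilde_qc_isIso`): each morphism from the dual of a quotient of `B` to a quotient of
the dual of `B` is a finite tensor, and the identity is a reordering of a fourfold finite sum
(`pairing_mul_mul`).

Both points rest on one device. A natural functional is evaluated at a universal element over a
square-zero algebra; specialization sends this element to `ε` times an arbitrary one, linearity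
extracts `ε`, and the `ε`-coefficients are compared. -/

/-- The trivial square-zero extension `S ⊕ M` carries a universal linear map `i` from `M`: up to a
factor `ε` with `ε ^ 2 = 0`, every linear map from `M` to a commutative algebra factors through
it. -/
theorem exists_universal_linearMap (M : Type u) [AddCommGroup M] [Module S M] :
    ∃ (T : Type u) (_ : CommRing T) (_ : Algebra S T) (i : M →ₗ[S] T) (κ : T →ₗ[S] M),
      (∀ m, κ (i m) = m) ∧
      ∀ (U : Type u) [CommRing U] [Algebra S U] (v : M →ₗ[S] U),
        ∃ ρ : T →ₐ[S] DualNumber U,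
          (∀ m, ρ (i m) = TrivSqZeroExt.inr (v m)) ∧ ∀ t, (ρ t).snd = v (κ t) := by
  -- The multiplication of the extension uses a right action; choosing it equal to the left one
  -- makes the ring commutative.
  let : Module Sᵐᵒᵖ M := Module.compHom _ ((RingHom.id S).fromOpposite mul_comm)
  have : IsCentralScalar S M := ⟨fun _ _ => rfl⟩
  refine ⟨TrivSqZeroExt S M, inferInstance, inferInstance, TrivSqZeroExt.inrHom S M,
    TrivSqZeroExt.sndHom S M, fun m => TrivSqZeroExt.snd_inr S m, fun U _ _ v => ?_⟩
  let ρ : TrivSqZeroExt S M →ₐ[S] DualNumber U :=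
    TrivSqZeroExt.lift (Algebra.ofId S (DualNumber U))
      ((TrivSqZeroExt.inrHom U U).restrictScalars S ∘ₗ v)
      (fun x y => by simp) (fun r x => by simp [Algebra.ofId_apply, Algebra.smul_def])
      (fun r x => by simp [Algebra.ofId_apply, Algebra.smul_def, mul_comm])
  have h₁ : ∀ m, ρ (TrivSqZeroExt.inr m) = TrivSqZeroExt.inr (v m) := fun m =>
    TrivSqZeroExt.lift_apply_inr _ _ _ _ _ m
  refine ⟨ρ, h₁, fun t => ?_⟩
  induction t using TrivSqZeroExt.ind with
  | inl_add_inr r m =>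
    have h₂ : ρ (TrivSqZeroExt.inl r) = TrivSqZeroExt.inl (algebraMap S U r) :=
      ρ.commutes r
    rw [map_add, h₁, h₂]
    simp

/-- A commutative algebra carrying a universal pair of linear maps from `M` and from `M'`. -/
theorem exists_universal_pair (M : Type u) [AddCommGroup M] [Module S M]
    (M' : Type u) [AddCommGroup M'] [Module S M'] :
    ∃ (T : Type u) (_ : CommRing T) (_ : Algebra S T) (i : M →ₗ[S] T) (i' : M' →ₗ[S] T)
      (κ : T →ₗ[S] M ⊗[S] M'),
      (∀ m m', κ (i m * i' m') = m ⊗ₜ m') ∧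
      ∀ (U : Type u) [CommRing U] [Algebra S U] (v : M →ₗ[S] U) (v' : M' →ₗ[S] U),
        ∃ ρ : T →ₐ[S] DualNumber (DualNumber U),
          (∀ m, ρ (i m) = TrivSqZeroExt.inl (TrivSqZeroExt.inr (v m))) ∧
          (∀ m, ρ (i' m) = TrivSqZeroExt.inr (TrivSqZeroExt.inl (v' m))) ∧
          ∀ t, (ρ t).snd.snd = TensorProduct.lift ((LinearMap.mul S U).compl₁₂ v v') (κ t) := by
  obtain ⟨D, _, _, i, κ, hi, hD⟩ := exists_universal_linearMap S M
  obtain ⟨D', _, _, i', κ', hi', hD'⟩ := exists_universal_linearMap S M'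
  refine ⟨D ⊗[S] D', Algebra.TensorProduct.instCommRing, Algebra.TensorProduct.instAlgebra,
    (Algebra.TensorProduct.includeLeft (S := S)).toLinearMap ∘ₗ i,
    (Algebra.TensorProduct.includeRight).toLinearMap ∘ₗ i',
    TensorProduct.map κ κ', fun m m' => by simp [hi, hi'], fun U _ _ v v' => ?_⟩
  obtain ⟨ρ, h₁, h₂⟩ := hD U v
  -- The second map is specialized over `U[ε]`, so that it produces an independent outer variable
  -- `ε'`, while the first map uses the inner `ε`. The coefficient of `εε'` then records the product
  -- of the two.
  obtain ⟨ρ', h₁', h₂'⟩ := hD' (DualNumber U) ((TrivSqZeroExt.inlAlgHom S U U).toLinearMap ∘ₗ v')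
  let σ : D ⊗[S] D' →ₐ[S] DualNumber (DualNumber U) :=
    Algebra.TensorProduct.productMap (S := DualNumber (DualNumber U))
      ((TrivSqZeroExt.inlAlgHom S (DualNumber U) (DualNumber U)).comp ρ) ρ'
  have hσ : ∀ t t', σ (t ⊗ₜ t') = TrivSqZeroExt.inl (ρ t) * ρ' t' := fun t t' =>
    Algebra.TensorProduct.productMap_apply_tmul _ _ t t'
  refine ⟨σ, fun m => ?_, fun m => ?_, fun t => ?_⟩
  · simp [hσ, h₁]
  · simp [hσ, h₁']
  · induction t with
    | zero => simp
    | add t t' ht ht' => simp only [map_add, TrivSqZeroExt.snd_add, ht, ht']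
    | tmul t t' => simp [hσ, h₂, h₂']

end Universal

/-! ## Quasi-coherent modules and their duals -/

variable {R : Type u} [CommRing R]

/-- A commutative `S`-algebra, seen as a commutative `R`-algebra. -/
def extend (S : CommAlgCat.{u} R) (T : Type u) [CommRing T] [Algebra S T] : CommAlgCat.{u} R :=
  letI := Algebra.compHom T (algebraMap R S)
  CommAlgCat.of R T

/-- The structure morphism of an `S`-algebra. -/
def extendHom (S : CommAlgCat.{u} R) (T : Type u) [CommRing T] [Algebra S T] :
    S ⟶ extend S T :=
  letI := Algebra.compHom T (algebraMap R S)
  CommAlgCat.ofHom { algebraMap S T with commutes' := fun _ => rfl }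

/-- A ring homomorphism that is compatible with a morphism `f : S ⟶ U` is a morphism from the
corresponding `S`-algebra. -/
def extendDesc {S U : CommAlgCat.{u} R} {T : Type u} [CommRing T] [Algebra S T] (f : S ⟶ U)
    (ρ : T →+* U) (h : ∀ s, ρ (algebraMap S T s) = f.hom s) : extend S T ⟶ U :=
  letI := Algebra.compHom T (algebraMap R S)
  CommAlgCat.ofHom { ρ with commutes' := fun r => (h _).trans (f.hom.commutes r) }

theorem extendHom_desc {S U : CommAlgCat.{u} R} {T : Type u} [CommRing T] [Algebra S T]
    (f : S ⟶ U) (ρ : T →+* U) (h : ∀ s, ρ (algebraMap S T s) = f.hom s) :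
    extendHom S T ≫ extendDesc f ρ h = f := by
  ext s
  exact h s

/-- The algebra of dual numbers `U[ε]`. -/
def dualNumber (U : CommAlgCat.{u} R) : CommAlgCat.{u} R := CommAlgCat.of R (DualNumber U)

/-- The inclusion `U ⟶ U[ε]`. -/
def dualNumberInl (U : CommAlgCat.{u} R) : U ⟶ dualNumber U :=
  CommAlgCat.ofHom (TrivSqZeroExt.inlAlgHom R U U)

/-- The infinitesimal is written as a scalar times a constant, the form in which linearity of a
functional can extract it. -/
theorem dualNumber_inl_inr {U : Type u} [CommRing U] (x : U) :
    (TrivSqZeroExt.inl (TrivSqZeroExt.inr x) : DualNumber (DualNumber U)) =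
      TrivSqZeroExt.inl (TrivSqZeroExt.inr 1) * TrivSqZeroExt.inl (TrivSqZeroExt.inl x) := by
  ext <;> simp

theorem dualNumber_inr_inl {U : Type u} [CommRing U] (x : U) :
    (TrivSqZeroExt.inr (TrivSqZeroExt.inl x) : DualNumber (DualNumber U)) =
      TrivSqZeroExt.inr (TrivSqZeroExt.inl 1) * TrivSqZeroExt.inl (TrivSqZeroExt.inl x) := by
  ext <;> simp

/-! ### Elementary tensors and their pairings -/

section tensor

variable {M : ModFunctor.{u, w} R} {N : ModFunctor.{u, w'} R} {S : CommAlgCat.{u} R}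

/-- The element `x ⊗ y` of a tensor product of functors of modules. -/
def tm (x : M.obj S) (y : N.obj S) : (tensor M N).obj S := x ⊗ₜ[S] y

theorem tensor_map_tm {T : CommAlgCat.{u} R} (f : S ⟶ T) (x : M.obj S) (y : N.obj S) :
    (tensor M N).map f (tm x y) = tm (M.map f x) (N.map f y) := rfl

theorem tm_smul_smul (s t : S) (x : M.obj S) (y : N.obj S) :
    tm (s • x) (t • y) = (s * t) • tm x y :=
  TensorProduct.smul_tmul_smul s t x y

theorem tensor_induction {p : (tensor M N).obj S → Prop} (z : (tensor M N).obj S)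
    (zero : p 0) (add : ∀ x y, p x → p y → p (x + y)) (tm : ∀ x y, p (tm x y)) : p z :=
  TensorProduct.induction_on (motive := p) z zero tm add

/-- The linear form on a tensor product given by a bilinear form. -/
def tensorLift (β : M.obj S →ₗ[S] N.obj S →ₗ[S] S) : (tensor M N).obj S →ₗ[S] S :=
  TensorProduct.lift β

theorem tensorLift_tm (β : M.obj S →ₗ[S] N.obj S →ₗ[S] S) (x : M.obj S) (y : N.obj S) :
    tensorLift β (tm x y) = β x y := TensorProduct.lift.tmul x y

/-- The pairing of `M ⊗ N` with `M^* ⊗ N^*`. -/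
def pair₂ (M : ModFunctor.{u, w} R) (N : ModFunctor.{u, w'} R) (S : CommAlgCat.{u} R) :
    (tensor M N).obj S →ₗ[S] (tensor (dual M) (dual N)).obj S →ₗ[S] S :=
  pairing₂ M N S

theorem pair₂_tm (x : M.obj S) (y : N.obj S) (a : (dual M).obj S) (b : (dual N).obj S) :
    pair₂ M N S (tm x y) (tm a b) = pairing M S x a * pairing N S y b := rfl

theorem toTilde_app (z : (tensor M N).obj S) (T : CommAlgCat.{u} R) (f : S ⟶ T)
    (c : (tensor (dual M) (dual N)).obj T) :
    DualElt.app ((toTilde M N).app S z) T f c = pair₂ M N T ((tensor M N).map f z) c := rfl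

end tensor

/-! ### Functionals on quasi-coherent modules -/

section qcDual

variable {A A' : Type u} [AddCommGroup A] [Module R A] [AddCommGroup A'] [Module R A']

/-- The element `s ⊗ a` of the quasi-coherent module associated with `A`. -/
def qcTmul {S : CommAlgCat.{u} R} (s : S) (a : A) : (qc R A).obj S := (s ⊗ₜ[R] a : S ⊗[R] A)

theorem qcTmul_eq_smul {S : CommAlgCat.{u} R} (s : S) (a : A) :
    qcTmul s a = s • qcTmul (1 : S) a := by
  change (s ⊗ₜ[R] a : S ⊗[R] A) = s • ((1 : S) ⊗ₜ[R] a : S ⊗[R] A)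
  rw [TensorProduct.smul_tmul', smul_eq_mul, mul_one]

theorem qcTmul_add {S : CommAlgCat.{u} R} (s : S) (a b : A) :
    qcTmul s (a + b) = qcTmul s a + qcTmul s b :=
  TensorProduct.tmul_add (R := R) (M := S) s a b

theorem qcTmul_smul {S : CommAlgCat.{u} R} (s : S) (r : R) (a : A) :
    qcTmul s (r • a) = algebraMap R S r • qcTmul s a := by
  change (s ⊗ₜ[R] (r • a) : S ⊗[R] A) = algebraMap R S r • (s ⊗ₜ[R] a : S ⊗[R] A)
  rw [TensorProduct.tmul_smul, algebraMap_smul]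

theorem qc_map_qcTmul {S T : CommAlgCat.{u} R} (f : S ⟶ T) (s : S) (a : A) :
    (qc R A).map f (qcTmul s a) = qcTmul (f.hom s) a := rfl

theorem qc_induction {S : CommAlgCat.{u} R} {p : (qc R A).obj S → Prop} (x : (qc R A).obj S)
    (zero : p 0) (add : ∀ x y, p x → p y → p (x + y)) (smul : ∀ (s : S) x, p x → p (s • x))
    (tmul : ∀ a : A, p (qcTmul (1 : S) a)) : p x :=
  TensorProduct.induction_on (motive := p) x zero
    (fun s a => by
      change p (qcTmul s a)
      rw [qcTmul_eq_smul]
      exact smul _ _ (tmul a)) add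

/-- The functional on a quasi-coherent module given by a linear map. -/
def DualElt.ofLinear {S : CommAlgCat.{u} R} (l : A →ₗ[R] S) : DualElt (qc R A) S where
  app T f := LinearMap.liftBaseChange T (f.hom.toLinearMap ∘ₗ l)
  naturality {T T'} f g := fun (x : T ⊗[R] A) => by
    change LinearMap.liftBaseChange T' ((f ≫ g).hom.toLinearMap ∘ₗ l)
      (g.hom.toLinearMap.rTensor A x) =
      g.hom (LinearMap.liftBaseChange T (f.hom.toLinearMap ∘ₗ l) x)
    induction x with
    | zero => simp
    | add x y hx hy => simp only [map_add, hx, hy]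
    | tmul t a => simp

theorem DualElt.ofLinear_app_qcTmul {S T : CommAlgCat.{u} R} (l : A →ₗ[R] S) (f : S ⟶ T) (t : T)
    (a : A) : (DualElt.ofLinear l).app T f (qcTmul t a) = t * f.hom (l a) := by
  change LinearMap.liftBaseChange T (f.hom.toLinearMap ∘ₗ l) (t ⊗ₜ[R] a) = _
  simp

/-- Functionals on a quasi-coherent module `S ↦ S ⊗ A` are determined by their values on `A`. -/
theorem DualElt.qc_ext {S : CommAlgCat.{u} R} {d d' : DualElt (qc R A) S}
    (h : ∀ a : A, d.app S (𝟙 S) (qcTmul (1 : S) a) = d'.app S (𝟙 S) (qcTmul (1 : S) a)) :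
    d = d' :=
  DualElt.ext' fun T f x => by
    induction x using qc_induction with
    | zero => simp
    | add x y hx hy => simp only [map_add, hx, hy]
    | smul s x hx => simp only [map_smul, hx]
    | tmul a =>
      have key : ∀ d : DualElt (qc R A) S,
          d.app T f (qcTmul (1 : T) a) = f.hom (d.app S (𝟙 S) (qcTmul (1 : S) a)) := fun d => by
        rw [← d.naturality (𝟙 S) f, Category.id_comp, qc_map_qcTmul, map_one]
      rw [key, key, h]

/-- The functional on a quasi-coherent module over `T` given by a linear map `S ⊗ A → T`. -/
def DualElt.ofExtend {S : CommAlgCat.{u} R} {T : Type u} [CommRing T] [Algebra S T]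
    (i : (qc R A).obj S →ₗ[S] T) : DualElt (qc R A) (extend S T) :=
  letI := Algebra.compHom T (algebraMap R S)
  let l : A →ₗ[R] T :=
    { toFun := fun a => i (qcTmul (1 : S) a)
      map_add' := fun a b => by rw [qcTmul_add, map_add]
      map_smul' := fun r a => by
        rw [qcTmul_smul, map_smul]
        rfl }
  DualElt.ofLinear (S := extend S T) l

theorem DualElt.ofExtend_app_qcTmul {S : CommAlgCat.{u} R} {T : Type u} [CommRing T] [Algebra S T]
    (i : (qc R A).obj S →ₗ[S] T) (a : A) :
    (DualElt.ofExtend i).app (extend S T) (𝟙 _) (qcTmul (1 : extend S T) a) =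
      i (qcTmul (1 : S) a) := by
  refine (DualElt.ofLinear_app_qcTmul _ _ _ _).trans ?_
  rw [one_mul]
  rfl

theorem DualElt.ofExtend_app {S : CommAlgCat.{u} R} {T : Type u} [CommRing T] [Algebra S T]
    (i : (qc R A).obj S →ₗ[S] T) (x : (qc R A).obj S) :
    (DualElt.ofExtend i).app (extend S T) (𝟙 _) ((qc R A).map (extendHom S T) x) = i x := by
  induction x using qc_induction with
  | zero => rw [map_zero, map_zero, map_zero]; rfl
  | add x y hx hy => rw [map_add, map_add, map_add, hx, hy]; rfl
  | smul s x hx =>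
    rw [LinearMap.map_smulₛₗ, map_smul, map_smul, hx, Algebra.smul_def]
    rfl
  | tmul a => rw [qc_map_qcTmul, map_one, DualElt.ofExtend_app_qcTmul]

/-- Elements of a quasi-coherent module are separated by functionals. -/
theorem qc_separated {S : CommAlgCat.{u} R} {x y : (qc R A).obj S}
    (h : ∀ (T : CommAlgCat.{u} R) (f : S ⟶ T) (d : (dual (qc R A)).obj T),
      pairing (qc R A) T ((qc R A).map f x) d = pairing (qc R A) T ((qc R A).map f y) d) :
    x = y := by
  obtain ⟨T, _, _, i, κ, hi, -⟩ := exists_universal_linearMap S ((qc R A).obj S)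
  have := h (extend S T) (extendHom S T) (DualElt.ofExtend i)
  have h' : i x = i y :=
    ((DualElt.ofExtend_app i x).symm.trans this).trans (DualElt.ofExtend_app i y)
  rw [← hi x, h', hi]

/-- Over a fixed base the two functionals only enter through the linear maps they induce on the
values at `S`, which is the data that the universal pair specializes to. -/
theorem pair₂_map_tm {S U : CommAlgCat.{u} R} (f : S ⟶ U) [Algebra S U]
    (v : (qc R A).obj S →ₗ[S] U) (v' : (qc R A').obj S →ₗ[S] U)
    (d : (dual (qc R A)).obj U) (d' : (dual (qc R A')).obj U)
    (hd : ∀ x, pairing (qc R A) U ((qc R A).map f x) d = v x)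
    (hd' : ∀ x, pairing (qc R A') U ((qc R A').map f x) d' = v' x)
    (z : (tensor (qc R A) (qc R A')).obj S) :
    pair₂ (qc R A) (qc R A') U ((tensor (qc R A) (qc R A')).map f z) (tm d d') =
      TensorProduct.lift ((LinearMap.mul S U).compl₁₂ v v') z := by
  induction z using tensor_induction with
  | zero => rw [map_zero, map_zero]; exact (map_zero _).symm
  | add x y hx hy =>
    rw [map_add, map_add, LinearMap.add_apply, hx, hy]
    exact (map_add _ _ _).symm
  | tm x x' =>
    rw [tensor_map_tm, pair₂_tm]
    rw [hd, hd']
    rfl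

/-- Everything is read off at the universal pair of functionals over `T`: `κ` recovers a tensor from
its value there, and applied to the value of an arbitrary functional on the tensor product of the
duals it yields a preimage. -/
theorem toTilde_qc_isIso : (toTilde (qc R A) (qc R A')).IsIso := fun S => by
  obtain ⟨T, _, _, i, i', κ, hκ, hT⟩ :=
    exists_universal_pair S ((qc R A).obj S) ((qc R A').obj S)
  let d : (dual (qc R A)).obj (extend S T) := DualElt.ofExtend i
  let d' : (dual (qc R A')).obj (extend S T) := DualElt.ofExtend i'
  constructor
  · intro z z' h
    have key : ∀ z : (tensor (qc R A) (qc R A')).obj S,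
        κ (pair₂ (qc R A) (qc R A') (extend S T)
          ((tensor (qc R A) (qc R A')).map (extendHom S T) z) (tm d d')) = z := fun z => by
      let : Algebra S (extend S T) := ‹Algebra S T›
      rw [pair₂_map_tm (extendHom S T) i i' d d' (DualElt.ofExtend_app i)
        (DualElt.ofExtend_app i')]
      induction z using tensor_induction with
      | zero => exact (congrArg κ (map_zero _)).trans (map_zero κ)
      | add x y hx hy =>
        exact (congrArg κ (map_add _ _ _)).trans
          ((map_add κ _ _).trans (congrArg₂ (· + ·) hx hy))
      | tm x x' => exact hκ x x'
    have h' := LinearMap.congr_fun (congrFun (congrFun (congrArg DualElt.app h) (extend S T))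
      (extendHom S T)) (tm d d')
    rw [← key z, ← key z']
    exact congrArg κ h'
  · intro Φ
    let Φ' : DualElt (tensor (dual (qc R A)) (dual (qc R A'))) S := Φ
    let t : T := Φ'.app (extend S T) (extendHom S T) (tm d d')
    refine ⟨κ t, DualElt.ext' fun U f c => ?_⟩
    change pair₂ (qc R A) (qc R A') U ((tensor (qc R A) (qc R A')).map f (κ t)) c =
      Φ'.app U f c
    induction c using tensor_induction with
    | zero => exact (map_zero _).trans (map_zero (Φ'.app U f)).symm
    | add x y hx hy => exact (map_add _ x y).trans ((congrArg₂ (· + ·) hx hy).trans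
        (map_add (Φ'.app U f) x y).symm)
    | tm v v' =>
      let : Algebra S U := f.hom.toRingHom.toAlgebra
      let l : (qc R A).obj S →ₗ[S] U :=
        { toFun := fun x => DualElt.app v U (𝟙 U) ((qc R A).map f x)
          map_add' := fun x y => by simp only [map_add]
          map_smul' := fun s x => by
            rw [LinearMap.map_smulₛₗ, map_smul]
            rfl }
      let l' : (qc R A').obj S →ₗ[S] U :=
        { toFun := fun x => DualElt.app v' U (𝟙 U) ((qc R A').map f x)
          map_add' := fun x y => by simp only [map_add]
          map_smul' := fun s x => by
            rw [LinearMap.map_smulₛₗ, map_smul]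
            rfl }
      obtain ⟨ρ, hρ, hρ', h⟩ := hT U l l'
      refine (pair₂_map_tm f l l' v v' (fun _ => rfl) (fun _ => rfl) _).trans ?_
      refine (h t).symm.trans ?_
      let W : CommAlgCat.{u} R := dualNumber (dualNumber U)
      let j : U ⟶ W := dualNumberInl U ≫ dualNumberInl (dualNumber U)
      let r : extend S T ⟶ W := extendDesc (f ≫ j) ρ.toRingHom fun s => ρ.commutes s
      have hj : extendHom S T ≫ r = f ≫ j := extendHom_desc _ _ _
      let ε : DualNumber (DualNumber U) := TrivSqZeroExt.inl (TrivSqZeroExt.inr 1)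
      let ε' : DualNumber (DualNumber U) := TrivSqZeroExt.inr (TrivSqZeroExt.inl 1)
      let e : W := ε
      let e' : W := ε'
      -- The universal functional specializes to an infinitesimal multiple of the given one. By
      -- `DualElt.qc_ext` this is checked on elements of `A`.
      have hd : (dual (qc R A)).map r d = e • (dual (qc R A)).map j v := by
        refine DualElt.qc_ext fun a => ?_
        have h₁ := DualElt.naturality d (𝟙 _) r (qcTmul (1 : extend S T) a)
        have h₂ := DualElt.naturality v (𝟙 _) j (qcTmul (1 : U) a)
        rw [Category.id_comp, qc_map_qcTmul, map_one, DualElt.ofExtend_app_qcTmul] at h₁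
        rw [Category.id_comp, qc_map_qcTmul, map_one] at h₂
        change d.app W (r ≫ 𝟙 _) _ = e * v.app W (j ≫ 𝟙 _) _
        rw [Category.comp_id, Category.comp_id, h₁, h₂]
        refine (hρ _).trans ?_
        have : l (qcTmul (1 : S) a) = v.app U (𝟙 U) (qcTmul 1 a) := by
          change v.app U (𝟙 U) ((qc R A).map f (qcTmul (1 : S) a)) = _
          rw [qc_map_qcTmul, map_one]
        rw [this]
        exact dualNumber_inl_inr _
      have hd' : (dual (qc R A')).map r d' = e' • (dual (qc R A')).map j v' := by
        refine DualElt.qc_ext fun a => ?_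
        have h₁ := DualElt.naturality d' (𝟙 _) r (qcTmul (1 : extend S T) a)
        have h₂ := DualElt.naturality v' (𝟙 _) j (qcTmul (1 : U) a)
        rw [Category.id_comp, qc_map_qcTmul, map_one, DualElt.ofExtend_app_qcTmul] at h₁
        rw [Category.id_comp, qc_map_qcTmul, map_one] at h₂
        change d'.app W (r ≫ 𝟙 _) _ = e' * v'.app W (j ≫ 𝟙 _) _
        rw [Category.comp_id, Category.comp_id, h₁, h₂]
        refine (hρ' _).trans ?_
        have : l' (qcTmul (1 : S) a) = v'.app U (𝟙 U) (qcTmul 1 a) := by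
          change v'.app U (𝟙 U) ((qc R A').map f (qcTmul (1 : S) a)) = _
          rw [qc_map_qcTmul, map_one]
        rw [this]
        exact dualNumber_inr_inl _
      have h₁ := Φ'.naturality (extendHom S T) r (tm d d')
      have h₂ := Φ'.naturality f j (tm v v')
      -- Naturality along `r` and along `j` computes the same value twice; bilinearity pulls out
      -- `εε'`, whose coefficient is the value of `Φ'` at the pair.
      rw [hj, tensor_map_tm, hd, hd', tm_smul_smul, map_smul, ← tensor_map_tm, h₂]
        at h₁
      have h₄ : ρ t = (ε * ε') * TrivSqZeroExt.inl (TrivSqZeroExt.inl (Φ'.app U f (tm v v'))) :=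
        h₁.symm
      rw [h₄]
      simp [ε, ε']

end qcDual

/-! ## The dual of an essentially free functor -/

theorem dualNumber_inr {U : Type u} [CommRing U] (x : U) :
    (TrivSqZeroExt.inr x : DualNumber U) = TrivSqZeroExt.inr 1 * TrivSqZeroExt.inl x := by
  ext <;> simp

section limFree

variable {I : Type u} {P : Set (Set I)} {S : CommAlgCat.{u} R}

/-- The subsets of `⋃₀ P` that meet every member of `P` in a finite set. -/
def dualFamily (P : Set (Set I)) : Set (Set I) :=
  {γ | γ ⊆ ⋃₀ P ∧ ∀ α ∈ P, (γ ∩ α).Finite}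

theorem union_mem_dualFamily : ∀ α ∈ dualFamily P, ∀ β ∈ dualFamily P, α ∪ β ∈ dualFamily P :=
  fun α hα β hβ => ⟨Set.union_subset hα.1 hβ.1, fun γ hγ => by
    rw [Set.union_inter_distrib_right]
    exact (hα.2 γ hγ).union (hβ.2 γ hγ)⟩

theorem singleton_mem_dualFamily {i : I} (hi : i ∈ ⋃₀ P) : {i} ∈ dualFamily P :=
  ⟨by simpa using hi, fun _ _ => (Set.finite_singleton i).inter_of_left _⟩

theorem mem_dualFamily_of_subset {γ δ : Set I} (hδ : δ ∈ dualFamily P) (h : γ ⊆ δ) :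
    γ ∈ dualFamily P :=
  ⟨h.trans hδ.1, fun α hα => (hδ.2 α hα).subset (Set.inter_subset_inter_left _ h)⟩

open Classical in
/-- The coordinates of an element of `lim_{α ∈ P} 𝓡^(α)`. -/
def coord (x : (limFree R P).obj S) (i : I) : S :=
  if h : ∃ α ∈ P, i ∈ α then x.1 ⟨h.choose, h.choose_spec.1⟩ ⟨i, h.choose_spec.2⟩ else 0

theorem coord_of_notMem (x : (limFree R P).obj S) {i : I} (hi : i ∉ ⋃₀ P) : coord x i = 0 :=
  dif_neg hi

theorem coord_add (x y : (limFree R P).obj S) (i : I) :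
    coord (x + y) i = coord x i + coord y i := by
  unfold coord
  split_ifs
  · rfl
  · simp

theorem coord_smul (s : S) (x : (limFree R P).obj S) (i : I) :
    coord (s • x) i = s * coord x i := by
  unfold coord
  split_ifs
  · rfl
  · simp

theorem coord_map {T : CommAlgCat.{u} R} (f : S ⟶ T) (x : (limFree R P).obj S) (i : I) :
    coord ((limFree R P).map f x) i = f.hom (coord x i) := by
  unfold coord
  split_ifs
  · rfl
  · simp

/-- Two members of `P` containing `i` lie in their union, again a member of `P`, so the coordinate
does not depend on the chosen member. -/
theorem coord_eq (hP : ∀ α ∈ P, ∀ β ∈ P, α ∪ β ∈ P) (x : (limFree R P).obj S) (α : P) (i : α.1) :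
    coord x i = x.1 α i := by
  have h : ∃ α ∈ P, i.1 ∈ α := ⟨α, α.2, i.2⟩
  refine (dif_pos h).trans ?_
  rw [← x.2 ⟨h.choose, h.choose_spec.1⟩ ⟨_, hP _ h.choose_spec.1 _ α.2⟩ Set.subset_union_left,
    ← x.2 α ⟨_, hP _ h.choose_spec.1 _ α.2⟩ Set.subset_union_right]

theorem coord_ext (hP : ∀ α ∈ P, ∀ β ∈ P, α ∪ β ∈ P) {x y : (limFree R P).obj S}
    (h : ∀ i, coord x i = coord y i) : x = y :=
  Subtype.ext <| funext fun α => Finsupp.ext fun i => by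
    rw [← coord_eq hP, ← coord_eq hP, h]

theorem support_coord_mem (hP : ∀ α ∈ P, ∀ β ∈ P, α ∪ β ∈ P) (x : (limFree R P).obj S) :
    Function.support (coord x) ∈ dualFamily P := by
  refine ⟨fun i hi => by_contra fun h => hi (coord_of_notMem x h), fun α hα => ?_⟩
  refine ((x.1 ⟨α, hα⟩).support.finite_toSet.image Subtype.val).subset fun i hi => ?_
  refine ⟨⟨i, hi.2⟩, ?_, rfl⟩
  have := hi.1
  rw [Function.mem_support, coord_eq hP x ⟨α, hα⟩ ⟨i, hi.2⟩] at this
  simpa using this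

/-- The element of `lim_{α ∈ P} 𝓡^(α)` with given coordinates. -/
def ofCoord (v : I → S) (hv : Function.support v ∈ dualFamily P) : (limFree R P).obj S :=
  ⟨fun α => Finsupp.ofSupportFinite (fun i : α.1 => v i) (by
    refine Set.Finite.of_finite_image ((hv.2 α.1 α.2).subset ?_) Subtype.val_injective.injOn
    rintro _ ⟨i, hi, rfl⟩
    exact ⟨hi, i.2⟩), fun _ _ _ _ => rfl⟩

theorem coord_ofCoord (v : I → S) (hv : Function.support v ∈ dualFamily P) (i : I) :
    coord (ofCoord v hv) i = v i := by
  by_cases h : ∃ α ∈ P, i ∈ α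
  · exact dif_pos h
  · rw [coord_of_notMem _ h]
    by_contra h'
    exact h (hv.1 (Ne.symm h'))

open Classical in
/-- The `i`-th basis element (which is zero if `i` is in no member of `P`). -/
def basisElt (P : Set (Set I)) (S : CommAlgCat.{u} R) (i : I) : (limFree R P).obj S :=
  ⟨fun α => if h : i ∈ α.1 then Finsupp.single ⟨i, h⟩ 1 else 0, fun α β h k => by
    have key : ∀ (α : P) (k : α.1),
        (if h : i ∈ α.1 then Finsupp.single ⟨i, h⟩ 1 else 0 : α.1 →₀ S) k =
          if i = k.1 then 1 else 0 := fun α k => by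
      split_ifs with h₁ h₂ h₂
      · subst h₂; simp
      · rw [Finsupp.single_apply, if_neg fun h => h₂ (congrArg Subtype.val h)]
      · exact absurd (h₂ ▸ k.2) h₁
      · rfl
    rw [key, key]⟩

open Classical in
theorem coord_basisElt {i : I} (hi : i ∈ ⋃₀ P) (k : I) :
    coord (basisElt P S i) k = if i = k then 1 else 0 := by
  by_cases h : ∃ α ∈ P, k ∈ α
  · refine (dif_pos h).trans ?_
    change (if h' : i ∈ h.choose then Finsupp.single ⟨i, h'⟩ 1 else 0 : h.choose →₀ S)
      ⟨k, h.choose_spec.2⟩ = _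
    split_ifs with h₁ h₂ h₂
    · subst h₂; simp
    · rw [Finsupp.single_apply, if_neg fun h => h₂ (congrArg Subtype.val h)]
    · exact absurd (h₂ ▸ h.choose_spec.2) h₁
    · rfl
  · rw [coord_of_notMem _ h, if_neg]
    rintro rfl
    exact h hi

theorem basisElt_of_notMem {i : I} (hi : i ∉ ⋃₀ P) : basisElt P S i = 0 :=
  Subtype.ext <| funext fun α => dif_neg fun h => hi ⟨α.1, α.2, h⟩

open Classical in
theorem map_basisElt {T : CommAlgCat.{u} R} (f : S ⟶ T) (i : I) :
    (limFree R P).map f (basisElt P S i) = basisElt P T i := by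
  refine Subtype.ext <| funext fun α => ?_
  change Finsupp.mapRange f.hom (map_zero f.hom) (dite _ _ _) = dite _ _ _
  split_ifs
  · simp
  · simp

/-- A functional on `lim_{α ∈ P} 𝓡^(α)` is a finite linear combination of the coordinates on the
elements supported in a given member of the dual family. -/
theorem exists_finsupp_of_mem_dualFamily (hP : ∀ α ∈ P, ∀ β ∈ P, α ∪ β ∈ P)
    (φ : DualElt (limFree R P) S) {γ : Set I} (hγ : γ ∈ dualFamily P) :
    ∃ y : γ →₀ S, ∀ (U : CommAlgCat.{u} R) (f : S ⟶ U) (x : (limFree R P).obj U),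
      Function.support (coord x) ⊆ γ →
      φ.app U f x = y.sum fun i s => f.hom s * coord x i := by
  classical
  obtain ⟨T, _, _, i, κ, hi, hT⟩ := exists_universal_linearMap S (γ →₀ S)
  -- The generic point supported in `γ`: its coordinates are the images of the basis vectors under
  -- the universal map, so it specializes to `ε` times any point supported in `γ`.
  let X : I → extend S T := fun k => if h : k ∈ γ then i (Finsupp.single ⟨k, h⟩ 1) else (0 : T)
  have hX : Function.support X ∈ dualFamily P :=
    mem_dualFamily_of_subset hγ fun k hk => by
      by_contra h
      exact hk (dif_neg h)
  let t : T := φ.app (extend S T) (extendHom S T) (ofCoord X hX)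
  refine ⟨κ t, fun U f x hx => ?_⟩
  let : Algebra S U := f.hom.toRingHom.toAlgebra
  obtain ⟨ρ, hρ, h⟩ := hT U (Finsupp.linearCombination S fun k : γ => coord x k)
  let W : CommAlgCat.{u} R := dualNumber U
  let j : U ⟶ W := dualNumberInl U
  let r : extend S T ⟶ W := extendDesc (f ≫ j) ρ.toRingHom fun s => ρ.commutes s
  have hj : extendHom S T ≫ r = f ≫ j := extendHom_desc _ _ _
  let e : W := (TrivSqZeroExt.inr 1 : DualNumber U)
  have hr : (limFree R P).map r (ofCoord X hX) = e • (limFree R P).map j x := by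
    refine coord_ext hP fun k => ?_
    rw [coord_map, coord_ofCoord, coord_smul, coord_map]
    change ρ (X k) = (TrivSqZeroExt.inr 1 : DualNumber U) * TrivSqZeroExt.inl (coord x k)
    by_cases hk : k ∈ γ
    · have : X k = i (Finsupp.single ⟨k, hk⟩ 1) := dif_pos hk
      rw [this, hρ, Finsupp.linearCombination_single, one_smul]
      exact dualNumber_inr _
    · have : X k = (0 : T) := dif_neg hk
      have hk' : coord x k = 0 := by
        by_contra h'
        exact hk (hx h')
      rw [this, hk', map_zero]
      exact (TrivSqZeroExt.inr_zero U).symm.trans (dualNumber_inr 0)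
  have h₁ := φ.naturality (extendHom S T) r (ofCoord X hX)
  have h₂ := φ.naturality f j x
  rw [hj, hr, map_smul, h₂] at h₁
  have h₃ : ρ t = (TrivSqZeroExt.inr 1 : DualNumber U) * TrivSqZeroExt.inl (φ.app U f x) := h₁.symm
  have h₄ := h t
  rw [h₃] at h₄
  simp only [TrivSqZeroExt.snd_mul, TrivSqZeroExt.fst_inr, TrivSqZeroExt.snd_inl, smul_zero,
    TrivSqZeroExt.fst_inl, TrivSqZeroExt.snd_inr, zero_add, MulOpposite.smul_eq_mul_unop,
    MulOpposite.unop_op, one_mul] at h₄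
  rw [h₄, Finsupp.linearCombination_apply]
  rfl

/-- The support of `x` is itself a member of the dual family, so the functional is a finite
combination of coordinates there, and basis elements identify its coefficients. The sum is finite
because of this choice of member, although the coefficients may be infinite in number. -/
theorem app_eq_finsum (hP : ∀ α ∈ P, ∀ β ∈ P, α ∪ β ∈ P) (φ : DualElt (limFree R P) S)
    {U : CommAlgCat.{u} R} (f : S ⟶ U) (x : (limFree R P).obj U) :
    φ.app U f x = ∑ᶠ i, f.hom (φ.app S (𝟙 S) (basisElt P S i)) * coord x i := by
  classical
  have hγ := support_coord_mem hP x
  obtain ⟨y, hy⟩ := exists_finsupp_of_mem_dualFamily hP φ hγ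
  have hy' : ∀ i : Function.support (coord x), φ.app S (𝟙 S) (basisElt P S i) = y i := fun i => by
    rw [hy S (𝟙 S) (basisElt P S i), Finsupp.sum, Finset.sum_eq_single i]
    · rw [coord_basisElt (hγ.1 i.2), if_pos rfl]
      exact mul_one _
    · intro k _ hk
      rw [coord_basisElt (hγ.1 i.2), if_neg fun h => hk (Subtype.ext h.symm), mul_zero]
    · intro h
      rw [Finsupp.notMem_support_iff.1 h, map_zero, zero_mul]
    · intro k hk
      rw [Function.mem_support, coord_basisElt (hγ.1 i.2), ne_eq, ite_eq_right_iff,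
        Classical.not_imp] at hk
      exact hk.1 ▸ i.2
  rw [hy U f x subset_rfl, Finsupp.sum,
    finsum_eq_sum_of_support_subset (s := y.support.image Subtype.val),
    Finset.sum_image Subtype.val_injective.injOn]
  · exact Finset.sum_congr rfl fun i _ => by rw [hy']
  · intro i hi
    have hi' : i ∈ Function.support (coord x) := fun h => hi (by simp only [h, mul_zero])
    refine Finset.mem_coe.2 (Finset.mem_image.2 ⟨⟨i, hi'⟩, ?_, rfl⟩)
    rw [Finsupp.mem_support_iff, ← hy']
    exact fun h => hi (by simp only [h, map_zero, zero_mul])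

theorem hasFiniteSupport_mul_coord (hP : ∀ α ∈ P, ∀ β ∈ P, α ∪ β ∈ P)
    (y : (limFree R (dualFamily P)).obj S) {U : CommAlgCat.{u} R} (f : S ⟶ U)
    (x : (limFree R P).obj U) :
    (fun i => f.hom (coord y i) * coord x i).HasFiniteSupport :=
  ((support_coord_mem union_mem_dualFamily y).2 _ (support_coord_mem hP x)).subset fun i hi =>
    ⟨fun h => hi (by simp only [h, map_zero, zero_mul]), fun h => hi (by simp only [h, mul_zero])⟩

/-- The functional `x ↦ ∑ yᵢ xᵢ`. -/
def ofDualFamily (hP : ∀ α ∈ P, ∀ β ∈ P, α ∪ β ∈ P) (y : (limFree R (dualFamily P)).obj S) :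
    DualElt (limFree R P) S where
  app U f :=
    { toFun := fun x => ∑ᶠ i, f.hom (coord y i) * coord x i
      map_add' := fun x x' => by
        rw [← finsum_add_distrib (hasFiniteSupport_mul_coord hP y f x)
          (hasFiniteSupport_mul_coord hP y f x')]
        simp only [coord_add, mul_add]
      map_smul' := fun s x => by
        have h := map_finsum (LinearMap.mulLeft U s) (hasFiniteSupport_mul_coord hP y f x)
        simp only [LinearMap.mulLeft_apply] at h
        rw [RingHom.id_apply, smul_eq_mul, h]
        simp only [coord_smul, mul_left_comm] }
  naturality {T T'} f g x := by
    change ∑ᶠ i, (f ≫ g).hom (coord y i) * coord ((limFree R P).map g x) i =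
      g.hom (∑ᶠ i, f.hom (coord y i) * coord x i)
    rw [map_finsum g.hom (hasFiniteSupport_mul_coord hP y f x)]
    simp only [coord_map, map_mul, CommAlgCat.hom_comp, AlgHom.comp_apply]

/-- On a member `γ` of the dual family the functional has a finitely supported coefficient vector,
whose entries are its values on the basis elements indexed by `γ`. -/
theorem support_app_basisElt_mem (hP : ∀ α ∈ P, ∀ β ∈ P, α ∪ β ∈ P)
    (φ : DualElt (limFree R P) S) :
    (Function.support fun i => φ.app S (𝟙 S) (basisElt P S i)) ∈ dualFamily (dualFamily P) := by
  classical
  have h : ∀ i ∈ Function.support fun i => φ.app S (𝟙 S) (basisElt P S i), i ∈ ⋃₀ P :=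
    fun i hi => by
      by_contra h
      exact hi (by simp only [basisElt_of_notMem h, map_zero])
  refine ⟨fun i hi => ⟨{i}, singleton_mem_dualFamily (h i hi), rfl⟩, fun γ hγ => ?_⟩
  obtain ⟨y, hy⟩ := exists_finsupp_of_mem_dualFamily hP φ hγ
  refine (y.support.finite_toSet.image Subtype.val).subset fun i hi => ⟨⟨i, hi.2⟩, ?_, rfl⟩
  rw [Finset.mem_coe, Finsupp.mem_support_iff]
  intro h0
  refine hi.1 ?_
  change φ.app S (𝟙 S) (basisElt P S i) = 0
  rw [hy S (𝟙 S)]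
  · refine Finset.sum_eq_zero fun k _ => ?_
    dsimp only
    rw [coord_basisElt (h i hi.1)]
    split_ifs with hk
    · have : k = ⟨i, hi.2⟩ := Subtype.ext hk.symm
      rw [this, h0, map_zero, zero_mul]
    · exact mul_zero _
  · intro k hk
    rw [Function.mem_support, coord_basisElt (h i hi.1), ne_eq, ite_eq_right_iff,
      Classical.not_imp] at hk
    exact hk.1 ▸ hi.2

/-- The dual of `lim_{α ∈ P} 𝓡^(α)` is the functor of the same kind given by the dual family. -/
def dualLimFree (hP : ∀ α ∈ P, ∀ β ∈ P, α ∪ β ∈ P) :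
    Hom (dual (limFree R P)) (limFree R (dualFamily P)) where
  app S :=
    { toFun := fun φ => ofCoord _ (support_app_basisElt_mem hP φ)
      map_add' := fun φ ψ => coord_ext union_mem_dualFamily fun i => by
        rw [coord_add, coord_ofCoord, coord_ofCoord, coord_ofCoord]
        rfl
      map_smul' := fun s φ => coord_ext union_mem_dualFamily fun i => by
        rw [RingHom.id_apply, coord_smul, coord_ofCoord, coord_ofCoord]
        rfl }
  naturality {S T} f φ := coord_ext union_mem_dualFamily fun i => by
    rw [coord_map]
    refine (coord_ofCoord _ (support_app_basisElt_mem hP ((dual (limFree R P)).map f φ)) i).trans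
      (.trans ?_ (congrArg f.hom (coord_ofCoord _ (support_app_basisElt_mem hP φ) i).symm))
    change DualElt.app φ T (f ≫ 𝟙 T) (basisElt P T i) =
      f.hom (DualElt.app φ S (𝟙 S) (basisElt P S i))
    have h := DualElt.naturality φ (𝟙 S) f (basisElt P S i)
    rw [map_basisElt, Category.id_comp] at h
    rw [Category.comp_id]
    exact h

theorem coord_dualLimFree (hP : ∀ α ∈ P, ∀ β ∈ P, α ∪ β ∈ P) (φ : DualElt (limFree R P) S)
    (i : I) : coord ((dualLimFree hP).app S φ) i = φ.app S (𝟙 S) (basisElt P S i) :=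
  coord_ofCoord _ (support_app_basisElt_mem hP φ) i

/-- A functional is the sum of its coefficients times the coordinates, hence is determined by them;
conversely an element with coordinates `yᵢ` pairs by finite sums, as its support and that of `x`
meet in a finite set. -/
theorem dualLimFree_isIso (hP : ∀ α ∈ P, ∀ β ∈ P, α ∪ β ∈ P) :
    (dualLimFree (R := R) hP).IsIso := fun S => by
  classical
  constructor
  · intro φ ψ h
    refine DualElt.ext' fun U f x => ?_
    refine (app_eq_finsum hP φ f x).trans (.trans ?_ (app_eq_finsum hP ψ f x).symm)
    refine finsum_congr fun i => ?_
    have h' := (coord_dualLimFree hP φ i).symm.trans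
      ((congrArg (coord · i) h).trans (coord_dualLimFree hP ψ i))
    exact congrArg (f.hom · * coord x i) h'
  · intro y
    refine ⟨ofDualFamily hP y, coord_ext union_mem_dualFamily fun i => ?_⟩
    rw [coord_dualLimFree]
    change ∑ᶠ k, coord y k * coord (basisElt P S i) k = coord y i
    by_cases hi : i ∈ ⋃₀ P
    · rw [finsum_eq_single _ i fun k hk => by rw [coord_basisElt hi, if_neg hk.symm, mul_zero],
        coord_basisElt hi, if_pos rfl, mul_one]
    -- Outside `⋃₀ P` the basis element is zero, and so is the coordinate of `y`, because members of
    -- the dual family lie in `⋃₀ P`.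
    · rw [coord_of_notMem y fun ⟨γ, hγ, h⟩ => hi (hγ.1 h)]
      refine finsum_eq_zero_of_forall_eq_zero fun k => ?_
      rw [basisElt_of_notMem hi]
      by_cases hk : ∃ α ∈ P, k ∈ α
      · exact (congrArg (coord y k * ·) (dif_pos hk)).trans (mul_zero _)
      · rw [coord_of_notMem _ hk, mul_zero]

theorem IsEssentiallyFree.dual {M : ModFunctor.{u, w} R} (h : IsEssentiallyFree M) :
    IsEssentiallyFree (dual M) := by
  obtain ⟨I, P, hP, e, he⟩ := h
  have he' : (e.inv he).IsIso := fun S =>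
    (LinearEquiv.ofBijective (e.app S) (he S)).symm.bijective
  exact ⟨I, dualFamily P, union_mem_dualFamily, (e.inv he).dual.comp (dualLimFree hP), fun S =>
    (dualLimFree_isIso hP S).comp (he'.dual S)⟩

end limFree

/-! ## Separation by functionals -/

section pairing

variable {M : ModFunctor.{u, w} R} {N : ModFunctor.{u, w'} R} {S T : CommAlgCat.{u} R}

theorem DualElt.app_eq_pairing (a : (dual M).obj S) (f : S ⟶ T) (x : M.obj T) :
    DualElt.app a T f x = pairing M T x ((dual M).map f a) := by
  change DualElt.app a T f x = DualElt.app a T (f ≫ 𝟙 T) x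
  rw [Category.comp_id]

theorem pairing_dual (f : Hom M N) (x : M.obj T) (a : (dual N).obj T) :
    pairing M T x (f.dual.app T a) = pairing N T (f.app T x) a := rfl

theorem pairing_ev (x : M.obj T) (a : (dual M).obj T) :
    pairing (dual M) T a ((ev M).app T x) = pairing M T x a := by
  change DualElt.app a T (𝟙 T) (M.map (𝟙 T) x) = DualElt.app a T (𝟙 T) x
  rw [M.map_id]

theorem pairing_map' (f : S ⟶ T) (x : M.obj S) (a : (dual M).obj S) :
    pairing M T (M.map f x) ((dual M).map f a) = f.hom (pairing M S x a) :=
  pairing_map M f x a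

theorem tensor_dualElt_ext {a b : (dual (tensor M N)).obj S}
    (h : ∀ (T : CommAlgCat.{u} R) (f : S ⟶ T) (x : M.obj T) (y : N.obj T),
      DualElt.app a T f (tm x y) = DualElt.app b T f (tm x y)) : a = b :=
  DualElt.ext' fun T f z => by
    induction z using tensor_induction with
    | zero => rw [map_zero, map_zero]
    | add x y hx hy => rw [map_add, map_add, hx, hy]
    | tm x y => exact h T f x y

theorem tensor_exists_finset (z : (tensor M N).obj S) :
    ∃ F : Finset (M.obj S × N.obj S), z = ∑ i ∈ F, tm i.1 i.2 :=
  TensorProduct.exists_finset z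

theorem tensor_mul_tm (a : AlgStruct M) (b : AlgStruct N) (x x' : M.obj S) (y y' : N.obj S) :
    (a.tensor b).mul S (tm x y) (tm x' y') = tm (a.mul S x x') (b.mul S y y') := rfl

end pairing

/-! ### Morphisms between quasi-coherent modules and duals as finite tensors -/

section qc

variable {A : Type u} [AddCommGroup A] [Module R A] {C : Type u} [AddCommGroup C] [Module R C]
  {C' : Type u} [AddCommGroup C'] [Module R C'] {S : CommAlgCat.{u} R}

theorem tensor_qc_separated {z z' : (tensor (qc R C) (qc R A)).obj S}
    (h : ∀ (T : CommAlgCat.{u} R) (f : S ⟶ T) (d : (dual (qc R C)).obj T)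
      (a : (dual (qc R A)).obj T),
      pair₂ _ _ T ((tensor (qc R C) (qc R A)).map f z) (tm d a) =
        pair₂ _ _ T ((tensor (qc R C) (qc R A)).map f z') (tm d a)) : z = z' :=
  (toTilde_qc_isIso S).1 (tensor_dualElt_ext h)

/-- A morphism from the dual of a quasi-coherent module to a quasi-coherent module is given by a
tensor. -/
theorem exists_tensor_of_hom (v : Hom (dual (qc R C)) (qc R A)) (S : CommAlgCat.{u} R) :
    ∃ F : Finset ((qc R C).obj S × (qc R A).obj S),
      ∀ (T : CommAlgCat.{u} R) (f : S ⟶ T) (d : (dual (qc R C)).obj T) (a : (dual (qc R A)).obj T),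
        pairing _ T (v.app T d) a =
          ∑ i ∈ F, pairing _ T ((qc R C).map f i.1) d * pairing _ T ((qc R A).map f i.2) a := by
  let Φ : DualElt (tensor (dual (qc R C)) (dual (qc R A))) S :=
    { app := fun T _ => tensorLift ((pairing (qc R A) T).comp (v.app T))
      naturality := fun {T T'} f g z => by
        induction z using tensor_induction with
        | zero => simp
        | add x y hx hy => simp only [map_add, hx, hy]
        | tm x y =>
          rw [tensor_map_tm, tensorLift_tm, tensorLift_tm, LinearMap.comp_apply,
            LinearMap.comp_apply, v.naturality, pairing_map'] }
  obtain ⟨z, hz⟩ := (toTilde_qc_isIso S).2 Φ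
  obtain ⟨F, rfl⟩ := tensor_exists_finset z
  refine ⟨F, fun T f d a => ?_⟩
  have h : DualElt.app ((toTilde (qc R C) (qc R A)).app S (∑ i ∈ F, tm i.1 i.2)) T f (tm d a) =
    pairing _ T (v.app T d) a := by rw [hz]; rfl
  rw [← h, toTilde_app, map_sum, map_sum, LinearMap.sum_apply]
  rfl

theorem app_eq_sum_of_pairing {ι : Type*} {F : Finset ι} {x : ι → (qc R C).obj S}
    {y : ι → (qc R A).obj S} {v : Hom (dual (qc R C)) (qc R A)}
    (hF : ∀ (T : CommAlgCat.{u} R) (f : S ⟶ T) (d : (dual (qc R C)).obj T)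
      (a : (dual (qc R A)).obj T), pairing _ T (v.app T d) a =
          ∑ i ∈ F, pairing _ T ((qc R C).map f (x i)) d * pairing _ T ((qc R A).map f (y i)) a)
    (T : CommAlgCat.{u} R) (f : S ⟶ T) (d : (dual (qc R C)).obj T) :
    v.app T d = ∑ i ∈ F, pairing _ T ((qc R C).map f (x i)) d • (qc R A).map f (y i) := by
  refine qc_separated fun T' g a => ?_
  rw [← v.naturality, hF T' (f ≫ g), map_sum, map_sum, LinearMap.sum_apply]
  refine Finset.sum_congr rfl fun i _ => ?_
  rw [LinearMap.map_smulₛₗ, map_smul, LinearMap.smul_apply, ModFunctor.map_comp,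
    ModFunctor.map_comp, pairing_map', smul_eq_mul]
  rfl

/-- Once `v` and `v'` are written as finite tensors, the form `(d, d') ↦ ⟨v(d) v'(d'), a⟩` is
visibly the pairing with an explicit tensor; separation by functionals identifies it with `z`. -/
theorem eq_sum_of_pair₂ (m : AlgStruct (qc R A)) {ι : Type*} {F : Finset ι}
    {x : ι → (qc R C).obj S} {y : ι → (qc R A).obj S} {v : Hom (dual (qc R C)) (qc R A)}
    (hF : ∀ (T : CommAlgCat.{u} R) (f : S ⟶ T) (d : (dual (qc R C)).obj T),
      v.app T d = ∑ i ∈ F, pairing _ T ((qc R C).map f (x i)) d • (qc R A).map f (y i))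
    {ι' : Type*} {F' : Finset ι'} {x' : ι' → (qc R C').obj S} {y' : ι' → (qc R A).obj S}
    {v' : Hom (dual (qc R C')) (qc R A)}
    (hF' : ∀ (T : CommAlgCat.{u} R) (f : S ⟶ T) (d : (dual (qc R C')).obj T),
      v'.app T d = ∑ i ∈ F', pairing _ T ((qc R C').map f (x' i)) d • (qc R A).map f (y' i))
    {z : (tensor (qc R C) (qc R C')).obj S} {a : (dual (qc R A)).obj S}
    (hz : ∀ (T : CommAlgCat.{u} R) (f : S ⟶ T) (d : (dual (qc R C)).obj T)
      (d' : (dual (qc R C')).obj T),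
      pair₂ _ _ T ((tensor (qc R C) (qc R C')).map f z) (tm d d') =
        pairing _ T (m.mul T (v.app T d) (v'.app T d')) ((dual (qc R A)).map f a)) :
    z = ∑ i ∈ F, ∑ j ∈ F', pairing _ S (m.mul S (y i) (y' j)) a • tm (x i) (x' j) := by
  refine tensor_qc_separated fun T f d d' => ?_
  rw [hz, hF T f, hF' T f]
  simp only [map_sum, LinearMap.sum_apply, map_smul, LinearMap.smul_apply, LinearMap.map_smulₛₗ,
    tensor_map_tm, pair₂_tm, ← m.map_mul, pairing_map', smul_eq_mul, Finset.mul_sum]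
  rw [Finset.sum_comm]
  refine Finset.sum_congr rfl fun i _ => Finset.sum_congr rfl fun j _ => ?_
  rw [rh_apply]
  ring

end qc

/-! ## Pro-quasicoherent algebras -/

theorem IsAlgHom.inv {M : ModFunctor.{u, w} R} {N : ModFunctor.{u, w'} R} {a : AlgStruct M}
    {b : AlgStruct N} {f : Hom M N} (h : IsAlgHom a b f) (hf : f.IsIso) :
    IsAlgHom b a (f.inv hf) :=
  ⟨fun S x y => by
    apply (hf S).1
    rw [h.1, f.app_inv, f.app_inv, f.app_inv], fun S => by
    apply (hf S).1
    rw [h.2, f.app_inv]⟩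

theorem IsAlgHom.comp {M : ModFunctor.{u, w} R} {N : ModFunctor.{u, w'} R}
    {L : ModFunctor.{u, w''} R} {a : AlgStruct M} {b : AlgStruct N} {c : AlgStruct L} {f : Hom M N}
    {g : Hom N L} (hf : IsAlgHom a b f) (hg : IsAlgHom b c g) : IsAlgHom a c (f.comp g) :=
  ⟨fun S x y => (congrArg (g.app S) (hf.1 S x y)).trans (hg.1 S _ _),
    fun S => (congrArg (g.app S) (hf.2 S)).trans (hg.2 S)⟩

section proqc

variable {M : ModFunctor.{u, w} R} {N : ModFunctor.{u, w'} R} {S : CommAlgCat.{u} R}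

/-- This is the uniqueness half of the limit property, applied to the compatible family of
projections of `x`. -/
theorem IsProQuasicoherent.eq_of_forall_proj {a : AlgStruct M} (h : IsProQuasicoherent a)
    {x y : M.obj S} (hxy : ∀ Q : QCQuotient a, Q.proj.app S x = Q.proj.app S y) : x = y := by
  refine (h S (fun Q => Q.proj.app S x) fun Q Q' k hk => ?_).unique (fun _ => rfl)
    fun Q => (hxy Q).symm
  rw [← hk]
  rfl

/-- The functionals that come from the quasi-coherent quotients of a functor of pro-quasicoherent
algebras are dense in its dual. -/
theorem IsProQuasicoherent.dual_dual_ext {a : AlgStruct M} (h : IsProQuasicoherent a)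
    (hr : IsReflexive M) {Φ Ψ : (dual (dual M)).obj S}
    (hΦ : ∀ (Q : QCQuotient a) (T : CommAlgCat.{u} R) (f : S ⟶ T) (c : (dual (qc R Q.alg)).obj T),
      DualElt.app Φ T f (Q.proj.dual.app T c) = DualElt.app Ψ T f (Q.proj.dual.app T c)) :
    Φ = Ψ := by
  obtain ⟨x, rfl⟩ := (hr S).2 Φ
  obtain ⟨y, rfl⟩ := (hr S).2 Ψ
  congr 1
  refine h.eq_of_forall_proj fun Q => qc_separated fun T f c => ?_
  rw [← Q.proj.naturality, ← Q.proj.naturality]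
  exact hΦ Q T f c

/-- The functional on `M^*` obtained by fixing the second argument of an element of `M ⊗~ N`. -/
def tildeLeft (Φ : (tilde M N).obj S) (ψ : (dual N).obj S) : (dual (dual M)).obj S :=
  (⟨fun T f =>
    { toFun := fun φ => DualElt.app Φ T f (tm φ ((dual N).map f ψ))
      map_add' := fun φ φ' =>
        (congrArg (DualElt.app Φ T f) (TensorProduct.add_tmul φ φ' _)).trans (map_add _ _ _)
      map_smul' := fun s φ =>
        (congrArg (DualElt.app Φ T f) (TensorProduct.smul_tmul' s φ _).symm).trans
          (map_smul (DualElt.app Φ T f) s _) }, fun {T T'} f g φ => by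
    change DualElt.app Φ T' (f ≫ g) (tm ((dual M).map g φ) ((dual N).map (f ≫ g) ψ)) =
      g.hom (DualElt.app Φ T f (tm φ ((dual N).map f ψ)))
    rw [(dual N).map_comp, ← tensor_map_tm]
    exact DualElt.naturality Φ f g _⟩ : DualElt (dual M) S)

/-- The functional on `N^*` obtained by fixing the first argument of an element of `M ⊗~ N`. -/
def tildeRight (Φ : (tilde M N).obj S) (φ : (dual M).obj S) : (dual (dual N)).obj S :=
  (⟨fun T f =>
    { toFun := fun ψ => DualElt.app Φ T f (tm ((dual M).map f φ) ψ)
      map_add' := fun ψ ψ' =>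
        (congrArg (DualElt.app Φ T f) (TensorProduct.tmul_add _ ψ ψ')).trans (map_add _ _ _)
      map_smul' := fun s ψ =>
        (congrArg (DualElt.app Φ T f) (TensorProduct.tmul_smul s _ ψ)).trans
          (map_smul (DualElt.app Φ T f) s _) }, fun {T T'} f g ψ => by
    change DualElt.app Φ T' (f ≫ g) (tm ((dual M).map (f ≫ g) φ) ((dual N).map g ψ)) =
      g.hom (DualElt.app Φ T f (tm ((dual M).map f φ) ψ))
    rw [(dual M).map_comp, ← tensor_map_tm]
    exact DualElt.naturality Φ f g _⟩ : DualElt (dual N) S)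

/-- The morphism from `M ⊗~ N` to the inverse limit of the `𝓐_i ⊗~ 𝓐'_j` is injective. -/
theorem tilde_ext {a : AlgStruct M} {b : AlgStruct N} (ha : IsProQuasicoherent a)
    (hb : IsProQuasicoherent b) (hM : IsReflexive M) (hN : IsReflexive N)
    {Φ Ψ : (tilde M N).obj S}
    (h : ∀ (Q : QCQuotient a) (Q' : QCQuotient b) (T : CommAlgCat.{u} R) (f : S ⟶ T)
      (c : (dual (qc R Q.alg)).obj T) (c' : (dual (qc R Q'.alg)).obj T),
      DualElt.app Φ T f (tm (Q.proj.dual.app T c) (Q'.proj.dual.app T c')) =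
        DualElt.app Ψ T f (tm (Q.proj.dual.app T c) (Q'.proj.dual.app T c'))) : Φ = Ψ := by
  -- Density is used one variable at a time: the first argument becomes arbitrary while the second
  -- still comes from a quotient.
  have h₁ : ∀ (Q' : QCQuotient b) (T : CommAlgCat.{u} R) (f : S ⟶ T) (φ : (dual M).obj T)
      (c' : (dual (qc R Q'.alg)).obj T),
      DualElt.app Φ T f (tm φ (Q'.proj.dual.app T c')) =
        DualElt.app Ψ T f (tm φ (Q'.proj.dual.app T c')) := fun Q' T f φ c' => by
    have key : tildeLeft ((tilde M N).map f Φ) (Q'.proj.dual.app T c') =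
        tildeLeft ((tilde M N).map f Ψ) (Q'.proj.dual.app T c') :=
      ha.dual_dual_ext hM fun Q U g c => by
        change DualElt.app Φ U (f ≫ g) (tm _ ((dual N).map g _)) =
          DualElt.app Ψ U (f ≫ g) (tm _ ((dual N).map g _))
        rw [← Q'.proj.dual.naturality]
        exact h Q Q' U _ c _
    have := LinearMap.congr_fun (congrFun (congrFun (congrArg DualElt.app key) T) (𝟙 T)) φ
    change DualElt.app Φ T (f ≫ 𝟙 T) (tm φ ((dual N).map (𝟙 T) _)) =
      DualElt.app Ψ T (f ≫ 𝟙 T) (tm φ ((dual N).map (𝟙 T) _)) at this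
    rwa [ModFunctor.map_id, Category.comp_id] at this
  refine tensor_dualElt_ext fun T f φ ψ => ?_
  have key : tildeRight ((tilde M N).map f Φ) φ = tildeRight ((tilde M N).map f Ψ) φ :=
    hb.dual_dual_ext hN fun Q' U g c' => h₁ Q' U (f ≫ g) _ c'
  have := LinearMap.congr_fun (congrFun (congrFun (congrArg DualElt.app key) T) (𝟙 T)) ψ
  change DualElt.app Φ T (f ≫ 𝟙 T) (tm ((dual M).map (𝟙 T) _) ψ) =
    DualElt.app Ψ T (f ≫ 𝟙 T) (tm ((dual M).map (𝟙 T) _) ψ) at this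
  rwa [ModFunctor.map_id, Category.comp_id] at this

theorem IsProQuasicoherent.transport {a : AlgStruct M} (h : IsProQuasicoherent a) (e : Hom M N)
    (he : e.IsIso) : IsProQuasicoherent (a.transport e he) := by
  have ht := a.isAlgHom_transport e he
  intro S x hx
  let push (Q : QCQuotient a) : QCQuotient (a.transport e he) :=
    { alg := Q.alg
      proj := (e.inv he).comp Q.proj
      isAlgHom := (ht.inv he).comp Q.isAlgHom
      isEpi := fun S y => by
        obtain ⟨x, rfl⟩ := Q.isEpi S y
        exact ⟨e.app S x, congrArg (Q.proj.app S) (e.inv_app he S x)⟩ }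
  let pull (Q : QCQuotient (a.transport e he)) : QCQuotient a :=
    { alg := Q.alg
      proj := e.comp Q.proj
      isAlgHom := ht.comp Q.isAlgHom
      isEpi := fun S y => by
        obtain ⟨x, rfl⟩ := Q.isEpi S y
        exact ⟨(e.inv he).app S x, congrArg (Q.proj.app S) (e.app_inv he S x)⟩ }
  obtain ⟨b, hb, hb'⟩ := h S (fun Q => x (push Q)) fun Q Q' k hk => hx (push Q) (push Q') k (by
    ext T y
    exact congrArg (fun p : Hom _ _ => p.app T ((e.inv he).app T y)) hk)
  refine ⟨e.app S b, fun Q => ?_, fun y hy => ?_⟩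
  · refine (hb (pull Q)).trans ?_
    have hid : ∀ (T : CommAlgCat.{u} R) (y : (qc R Q.alg).obj T),
        (qcMap (AlgHom.id R Q.alg).toLinearMap).app T y = y := fun T y => by
      change LinearMap.baseChange T (AlgHom.id R Q.alg).toLinearMap y = y
      rw [AlgHom.toLinearMap_id, LinearMap.baseChange_id]
      rfl
    -- The quotients `push (pull Q)` and `Q` share their algebra, and their projections agree
    -- pointwise; compatibility of the family along the identity map avoids rewriting in dependent
    -- types.
    rw [← hx (push (pull Q)) Q (AlgHom.id R Q.alg)]
    · exact (hid S _).symm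
    · ext T y
      exact (hid T _).trans (congrArg (Q.proj.app T) (e.app_inv he T y))
  · rw [← hb' ((e.inv he).app S y) fun Q => hy (push Q), e.app_inv]

end proqc

/-! ## The dual of a functor of bialgebras -/

section bialgebra

variable {B : ModFunctor.{u, w} R} {S : CommAlgCat.{u} R}

theorem comul_app (d : AlgStruct (dual B)) (x : B.obj S) {T : CommAlgCat.{u} R} (f : S ⟶ T)
    (φ ψ : (dual B).obj T) :
    DualElt.app ((comul d).app S x) T f (tm φ ψ) = pairing B T (B.map f x) (d.mul T φ ψ) := rfl

theorem counit_app (d : AlgStruct (dual B)) (x : B.obj S) :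
    (counit d).app S x = pairing B S x (d.one S) := by
  change DualElt.app ((1 : S) • d.one S : (dual B).obj S) S (𝟙 S) (B.map (𝟙 S) x) = _
  rw [one_smul, B.map_id]
  rfl

/-- The components of the comultiplication of a functor of bialgebras. -/
theorem IsAlgHomToTilde.exists_pair₂ {b : AlgStruct B} {d : AlgStruct (dual B)}
    (h : IsAlgHomToTilde b b (comul d)) (Q Q' : QCQuotient b) :
    ∃ g : Hom B (tensor (qc R Q.alg) (qc R Q'.alg)),
      IsAlgHom b ((qcAlg R Q.alg).tensor (qcAlg R Q'.alg)) g ∧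
      ∀ (S T : CommAlgCat.{u} R) (f : S ⟶ T) (x : B.obj S) (c : (dual (qc R Q.alg)).obj T)
        (c' : (dual (qc R Q'.alg)).obj T),
        pair₂ _ _ T ((tensor (qc R Q.alg) (qc R Q'.alg)).map f (g.app S x)) (tm c c') =
          pairing B T (B.map f x) (d.mul T (Q.proj.dual.app T c) (Q'.proj.dual.app T c')) := by
  obtain ⟨g, hg, hg'⟩ := h Q Q'
  refine ⟨g, hg, fun S T f x c c' => ?_⟩
  have := congrArg (fun k : Hom B (tilde (qc R Q.alg) (qc R Q'.alg)) =>
    DualElt.app (k.app S x) T f (tm c c')) hg'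
  exact this

/-- The comultiplication preserves units in every component, so it sends `1` to `1 ⊗ 1` by
`tilde_ext`; evaluation at `φ ⊗ ψ` gives the formula. -/
theorem comul_one {b : AlgStruct B} {d : AlgStruct (dual B)} (hr : IsReflexive B)
    (hb : IsProQuasicoherent b) (h : IsAlgHomToTilde b b (comul d)) (φ ψ : (dual B).obj S) :
    pairing B S (b.one S) (d.mul S φ ψ) =
      pairing B S (b.one S) φ * pairing B S (b.one S) ψ := by
  have key : (comul d).app S (b.one S) = (toTilde B B).app S (tm (b.one S) (b.one S)) := by
    refine tilde_ext hb hb hr hr fun Q Q' T f c c' => ?_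
    obtain ⟨g, hg, hg'⟩ := h.exists_pair₂ Q Q'
    rw [comul_app, ← hg', hg.2, toTilde_app, AlgStruct.map_one, tensor_map_tm, b.map_one, pair₂_tm,
      pairing_dual, pairing_dual, Q.isAlgHom.2, Q'.isAlgHom.2]
    rfl
  have := LinearMap.congr_fun (congrFun (congrFun (congrArg DualElt.app key) S) (𝟙 S)) (tm φ ψ)
  rw [comul_app, toTilde_app, ModFunctor.map_id, ModFunctor.map_id, pair₂_tm] at this
  exact this

theorem counit_transport_app (b : AlgStruct B) (hr : IsReflexive B) (φ : (dual B).obj S) :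
    (counit (b.transport (ev B) hr)).app S φ = pairing B S (b.one S) φ := by
  rw [counit_app]
  exact pairing_ev _ _

/-- The counit of the dual is evaluation at `1`. It is multiplicative by `comul_one`, and its value
at the unit is the counit of `B` at `1`. -/
theorem counit_dual_isAlgHom {b : AlgStruct B} {d : AlgStruct (dual B)} (hr : IsReflexive B)
    (hb : IsProQuasicoherent b) (h : IsAlgHomToTilde b b (comul d))
    (h' : IsAlgHom b (AlgStruct.ofUnit R) (counit d)) :
    IsAlgHom d (AlgStruct.ofUnit R) (counit (b.transport (ev B) hr)) := by
  refine ⟨fun S φ ψ => ?_, fun S => ?_⟩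
  · rw [counit_transport_app, counit_transport_app, counit_transport_app]
    exact comul_one hr hb h φ ψ
  · rw [counit_transport_app, ← counit_app, h'.2]

end bialgebra

/-! ### The comultiplication of the dual -/

section bialgebra

variable {B : ModFunctor.{u, w} R}

/-- The transpose `N^* → B` of a morphism `B^* → N`, for a reflexive functor `B`. -/
def transpose {N : ModFunctor.{u, w'} R} (hr : IsReflexive B) (p : Hom (dual B) N) :
    Hom (dual N) B :=
  p.dual.comp ((ev B).inv hr)

theorem ev_transpose {N : ModFunctor.{u, w'} R} (hr : IsReflexive B) (p : Hom (dual B) N)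
    {S : CommAlgCat.{u} R} (a : (dual N).obj S) :
    (ev B).app S ((transpose hr p).app S a) = p.dual.app S a :=
  (ev B).app_inv hr S _

theorem pairing_transpose {N : ModFunctor.{u, w'} R} (hr : IsReflexive B) (p : Hom (dual B) N)
    {S : CommAlgCat.{u} R} (a : (dual N).obj S) (φ : (dual B).obj S) :
    pairing B S ((transpose hr p).app S a) φ = pairing N S (p.app S φ) a := by
  rw [← pairing_ev, ev_transpose, pairing_dual]

/-- Finite families in the products `Mᵢ × Nⱼ` give elements of `M₁ ⊗ M₂` and of `N₁ ⊗ N₂`; the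
products of these elements have the same values on the given functionals. -/
theorem sum_interchange {M₁ : ModFunctor.{u, w} R} {M₂ : ModFunctor.{u, w} R}
    {N₁ : ModFunctor.{u, w} R} {N₂ : ModFunctor.{u, w} R} {S : CommAlgCat.{u} R}
    (m₁ : AlgStruct M₁) (m₂ : AlgStruct M₂) (n₁ : AlgStruct N₁) (n₂ : AlgStruct N₂)
    {ι₁ ι₂ ι₃ ι₄ : Type*} (F₁ : Finset ι₁) (F₂ : Finset ι₂) (F₃ : Finset ι₃) (F₄ : Finset ι₄)
    (x₁ : ι₁ → M₁.obj S) (y₁ : ι₁ → N₁.obj S) (x₂ : ι₂ → M₂.obj S) (y₂ : ι₂ → N₁.obj S)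
    (x₃ : ι₃ → M₁.obj S) (y₃ : ι₃ → N₂.obj S) (x₄ : ι₄ → M₂.obj S) (y₄ : ι₄ → N₂.obj S)
    (c₁ : (dual M₁).obj S) (c₂ : (dual M₂).obj S) (a₁ : (dual N₁).obj S) (a₂ : (dual N₂).obj S) :
    pair₂ M₁ M₂ S ((m₁.tensor m₂).mul S
      (∑ i ∈ F₁, ∑ j ∈ F₂, pairing N₁ S (n₁.mul S (y₁ i) (y₂ j)) a₁ • tm (x₁ i) (x₂ j))
      (∑ k ∈ F₃, ∑ l ∈ F₄, pairing N₂ S (n₂.mul S (y₃ k) (y₄ l)) a₂ • tm (x₃ k) (x₄ l)))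
      (tm c₁ c₂) =
    pair₂ N₁ N₂ S ((n₁.tensor n₂).mul S
      (∑ i ∈ F₁, ∑ k ∈ F₃, pairing M₁ S (m₁.mul S (x₁ i) (x₃ k)) c₁ • tm (y₁ i) (y₃ k))
      (∑ j ∈ F₂, ∑ l ∈ F₄, pairing M₂ S (m₂.mul S (x₂ j) (x₄ l)) c₂ • tm (y₂ j) (y₄ l)))
      (tm a₁ a₂) := by
  -- Both sides become fourfold sums of `c₁(x₁x₃) c₂(x₂x₄) a₁(y₁y₂) a₂(y₃y₄)`; only the order of
  -- summation differs.
  simp only [map_sum, LinearMap.sum_apply, map_smul, LinearMap.smul_apply, tensor_mul_tm, pair₂_tm,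
    smul_eq_mul, Finset.mul_sum]
  rw [Finset.sum_comm, Finset.sum_comm (s := F₂)]
  refine Finset.sum_congr rfl fun l _ => ?_
  rw [Finset.sum_comm, Finset.sum_comm (s := F₂)]
  refine Finset.sum_congr rfl fun i _ => ?_
  rw [Finset.sum_comm]
  refine Finset.sum_congr rfl fun j _ => Finset.sum_congr rfl fun k _ => ?_
  ring

/-- The compatibility of the two products of a functor of bialgebras, on functionals that come from
quasi-coherent quotients. -/
theorem pairing_mul_mul {b : AlgStruct B} {d : AlgStruct (dual B)} (hr : IsReflexive B)
    (h : IsAlgHomToTilde b b (comul d)) (Q Q' : QCQuotient d)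
    (g : Hom (dual B) (tensor (qc R Q.alg) (qc R Q'.alg)))
    (hg : ∀ (S T : CommAlgCat.{u} R) (f : S ⟶ T) (φ : (dual B).obj S)
      (a : (dual (qc R Q.alg)).obj T) (a' : (dual (qc R Q'.alg)).obj T),
      pair₂ _ _ T ((tensor (qc R Q.alg) (qc R Q'.alg)).map f (g.app S φ)) (tm a a') =
        pairing B T (b.mul T ((transpose hr Q.proj).app T a) ((transpose hr Q'.proj).app T a'))
          ((dual B).map f φ))
    (P P' : QCQuotient b) {S : CommAlgCat.{u} R} (c : (dual (qc R P.alg)).obj S)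
    (c' : (dual (qc R P'.alg)).obj S) (a : (dual (qc R Q.alg)).obj S)
    (a' : (dual (qc R Q'.alg)).obj S) :
    pairing B S (b.mul S ((transpose hr Q.proj).app S a) ((transpose hr Q'.proj).app S a'))
      (d.mul S (P.proj.dual.app S c) (P'.proj.dual.app S c')) =
    pair₂ _ _ S (((qcAlg R Q.alg).tensor (qcAlg R Q'.alg)).mul S
      (g.app S (P.proj.dual.app S c)) (g.app S (P'.proj.dual.app S c'))) (tm a a') := by
  obtain ⟨k, hk, hk'⟩ := h.exists_pair₂ P P'
  have hz := hk' S S (𝟙 S) (b.mul S ((transpose hr Q.proj).app S a)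
    ((transpose hr Q'.proj).app S a')) c c'
  rw [ModFunctor.map_id, ModFunctor.map_id, hk.1] at hz
  rw [← hz]
  have expand : ∀ (Q : QCQuotient d) (P : QCQuotient b),
      ∃ F : Finset ((qc R P.alg).obj S × (qc R Q.alg).obj S),
        (∀ (T : CommAlgCat.{u} R) (f : S ⟶ T) (c : (dual (qc R P.alg)).obj T),
          (P.proj.dual.comp Q.proj).app T c =
            ∑ i ∈ F, pairing _ T ((qc R P.alg).map f i.1) c • (qc R Q.alg).map f i.2) ∧
        ∀ (T : CommAlgCat.{u} R) (f : S ⟶ T) (a : (dual (qc R Q.alg)).obj T),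
          ((transpose hr Q.proj).comp P.proj).app T a =
            ∑ i ∈ F, pairing _ T ((qc R Q.alg).map f i.2) a • (qc R P.alg).map f i.1 :=
    fun Q P => by
      obtain ⟨F, hF⟩ := exists_tensor_of_hom (P.proj.dual.comp Q.proj) S
      -- One tensor serves for the morphism and for its transpose, because both define the same
      -- bilinear form.
      refine ⟨F, app_eq_sum_of_pairing hF, app_eq_sum_of_pairing fun T f a c => ?_⟩
      have := hF T f c a
      simp only [mul_comm] at this ⊢
      rw [← this]
      exact pairing_transpose hr Q.proj a (P.proj.dual.app T c)
  obtain ⟨F₁, h₁, h₁'⟩ := expand Q P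
  obtain ⟨F₂, h₂, h₂'⟩ := expand Q P'
  obtain ⟨F₃, h₃, h₃'⟩ := expand Q' P
  obtain ⟨F₄, h₄, h₄'⟩ := expand Q' P'
  have hk₂ : ∀ (Q : QCQuotient d) (a : (dual (qc R Q.alg)).obj S) (T : CommAlgCat.{u} R)
      (f : S ⟶ T) (c : (dual (qc R P.alg)).obj T) (c' : (dual (qc R P'.alg)).obj T),
      pair₂ _ _ T ((tensor (qc R P.alg) (qc R P'.alg)).map f
        (k.app S ((transpose hr Q.proj).app S a))) (tm c c') =
      pairing _ T ((qcAlg R Q.alg).mul T ((P.proj.dual.comp Q.proj).app T c)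
        ((P'.proj.dual.comp Q.proj).app T c')) ((dual (qc R Q.alg)).map f a) :=
    fun Q a T f c c' => by
      rw [hk', ← (transpose hr Q.proj).naturality, pairing_transpose, Q.isAlgHom.1]
      rfl
  have hg₂ : ∀ (P : QCQuotient b) (c : (dual (qc R P.alg)).obj S) (T : CommAlgCat.{u} R)
      (f : S ⟶ T) (a : (dual (qc R Q.alg)).obj T) (a' : (dual (qc R Q'.alg)).obj T),
      pair₂ _ _ T ((tensor (qc R Q.alg) (qc R Q'.alg)).map f
        (g.app S (P.proj.dual.app S c))) (tm a a') =
      pairing _ T ((qcAlg R P.alg).mul T (((transpose hr Q.proj).comp P.proj).app T a)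
        (((transpose hr Q'.proj).comp P.proj).app T a')) ((dual (qc R P.alg)).map f c) :=
    fun P c T f a a' => by
      rw [hg, ← P.proj.dual.naturality, pairing_dual, P.isAlgHom.1]
      rfl
  rw [eq_sum_of_pair₂ _ h₁ h₂ (hk₂ Q a), eq_sum_of_pair₂ _ h₃ h₄ (hk₂ Q' a'),
    eq_sum_of_pair₂ _ h₁' h₃' (hg₂ P c), eq_sum_of_pair₂ _ h₂' h₄' (hg₂ P' c')]
  exact sum_interchange _ _ _ _ F₁ F₂ F₃ F₄ _ _ _ _ _ _ _ _ c c' a a'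

/-- The functional on `M ⊗ N` given by a functional on `M` and a functional on `N`. -/
def tensorDual {M : ModFunctor.{u, w} R} {N : ModFunctor.{u, w'} R} {S : CommAlgCat.{u} R}
    (a : (dual M).obj S) (a' : (dual N).obj S) : (dual (tensor M N)).obj S :=
  (⟨fun T f => (pair₂ M N T).flip (tm ((dual M).map f a) ((dual N).map f a')),
    fun {T T'} f g z => by
      rw [LinearMap.flip_apply, LinearMap.flip_apply, ModFunctor.map_comp, ModFunctor.map_comp,
        ← tensor_map_tm]
      exact pairing₂_map M N g _ _⟩ : DualElt (tensor M N) S)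

/-- Multiplicativity is tested against functionals `a ⊗ a'` and reduced by density to
`pairing_mul_mul`; preservation of the unit is the multiplicativity of the counit of `B`. -/
theorem comul_dual_isAlgHomToTilde {b : AlgStruct B} {d : AlgStruct (dual B)} (hr : IsReflexive B)
    (hb : IsProQuasicoherent b) (h : IsAlgHomToTilde b b (comul d))
    (h' : IsAlgHom b (AlgStruct.ofUnit R) (counit d)) :
    IsAlgHomToTilde d d (comul (b.transport (ev B) hr)) := by
  intro Q Q'
  let g : Hom (dual B) (tensor (qc R Q.alg) (qc R Q'.alg)) :=
    ((comul (b.transport (ev B) hr)).comp (Q.proj.tilde Q'.proj)).comp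
      ((toTilde _ _).inv toTilde_qc_isIso)
  have hg₀ : ∀ (S : CommAlgCat.{u} R) (φ : (dual B).obj S),
      (toTilde _ _).app S (g.app S φ) =
        ((comul (b.transport (ev B) hr)).comp (Q.proj.tilde Q'.proj)).app S φ := fun S φ =>
    (toTilde _ _).app_inv toTilde_qc_isIso S _
  have hg : ∀ (S T : CommAlgCat.{u} R) (f : S ⟶ T) (φ : (dual B).obj S)
      (a : (dual (qc R Q.alg)).obj T) (a' : (dual (qc R Q'.alg)).obj T),
      pair₂ _ _ T ((tensor (qc R Q.alg) (qc R Q'.alg)).map f (g.app S φ)) (tm a a') =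
        pairing B T (b.mul T ((transpose hr Q.proj).app T a) ((transpose hr Q'.proj).app T a'))
          ((dual B).map f φ) := fun S T f φ a a' => by
    rw [← toTilde_app, hg₀, ← pairing_ev, (b.isAlgHom_transport (ev B) hr).1, ev_transpose,
      ev_transpose]
    rfl
  have hmul : ∀ (S : CommAlgCat.{u} R) (φ ψ : (dual B).obj S) (a : (dual (qc R Q.alg)).obj S)
      (a' : (dual (qc R Q'.alg)).obj S),
      pairing B S (b.mul S ((transpose hr Q.proj).app S a) ((transpose hr Q'.proj).app S a'))
        (d.mul S φ ψ) =
      pair₂ _ _ S (((qcAlg R Q.alg).tensor (qcAlg R Q'.alg)).mul S (g.app S φ) (g.app S ψ))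
        (tm a a') := fun S φ ψ a a' => by
    -- Letting `φ` and `ψ` vary turns the right-hand side into an element of `B ⊗~ B`, so that
    -- `tilde_ext` applies.
    let k : Hom (tensor (dual B) (dual B)) (tensor (qc R Q.alg) (qc R Q'.alg)) :=
      (g.tensor g).comp ((qcAlg R Q.alg).tensor (qcAlg R Q'.alg)).mulHom
    have hk : ∀ (T : CommAlgCat.{u} R) (φ ψ : (dual B).obj T), k.app T (tm φ ψ) =
        ((qcAlg R Q.alg).tensor (qcAlg R Q'.alg)).mul T (g.app T φ) (g.app T ψ) :=
      fun _ _ _ => rfl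
    have hk' : ∀ (T : CommAlgCat.{u} R) (f : S ⟶ T) (φ ψ : (dual B).obj T),
        DualElt.app (k.dual.app S (tensorDual a a')) T f (tm φ ψ) =
        pair₂ _ _ T (k.app T (tm φ ψ))
          (tm ((dual (qc R Q.alg)).map f a) ((dual (qc R Q'.alg)).map f a')) :=
      fun _ _ _ _ => rfl
    have key : (comul d).app S (b.mul S ((transpose hr Q.proj).app S a)
        ((transpose hr Q'.proj).app S a')) = k.dual.app S (tensorDual a a') := by
      refine tilde_ext hb hb hr hr fun P P' T f c c' => ?_
      rw [comul_app, hk', hk, b.map_mul, ← (transpose hr Q.proj).naturality,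
        ← (transpose hr Q'.proj).naturality]
      exact pairing_mul_mul hr h Q Q' g hg P P' c c' _ _
    have := LinearMap.congr_fun (congrFun (congrFun (congrArg DualElt.app key) S) (𝟙 S)) (tm φ ψ)
    rw [hk', hk, comul_app] at this
    rwa [ModFunctor.map_id, ModFunctor.map_id, ModFunctor.map_id] at this
  have hone : ∀ (T : CommAlgCat.{u} R) (x y : B.obj T), pairing B T (b.mul T x y) (d.one T) =
      pairing B T x (d.one T) * pairing B T y (d.one T) := fun T x y => by
    have := h'.1 T x y
    rw [counit_app, counit_app, counit_app] at this
    exact this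
  refine ⟨g, ⟨fun S φ ψ => tensor_qc_separated fun T f a a' => ?_, fun S =>
    tensor_qc_separated fun T f a a' => ?_⟩, ?_⟩
  · rw [hg, d.map_mul, hmul, AlgStruct.map_mul, g.naturality, g.naturality]
  · rw [hg, d.map_one, hone, AlgStruct.map_one, pairing_transpose, pairing_transpose,
      Q.isAlgHom.2, Q'.isAlgHom.2]
    rfl
  · ext S φ : 3
    exact hg₀ S φ

end bialgebra

namespace BiAlgFunctor

theorem IsFBialg.dual {B : BiAlgFunctor R} (h : IsFBialg B) : IsFBialg B.dual where
  proqc := h.dual_proqc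
  comul_isAlgHom :=
    comul_dual_isAlgHomToTilde B.reflexive h.proqc h.comul_isAlgHom h.counit_isAlgHom
  counit_isAlgHom := counit_dual_isAlgHom B.reflexive h.proqc h.comul_isAlgHom h.counit_isAlgHom
  essentiallyFree := h.essentiallyFree.dual
  dual_proqc := h.proqc.transport (ev B.carrier) B.reflexive

end BiAlgFunctor

/-! ## The duality -/

theorem Hom.dual_injective {M : ModFunctor.{u, w} R} {N : ModFunctor.{u, w'} R}
    (hN : IsReflexive N) {f g : Hom M N} (h : f.dual = g.dual) : f = g := by
  ext S x
  apply (hN S).1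
  rw [← ev_naturality, ← ev_naturality, h]

/-- Source of fullness: by reflexivity every morphism between duals is itself a transpose. -/
theorem dual_transpose {M : ModFunctor.{u, w} R} {N : ModFunctor.{u, w'} R} (hM : IsReflexive M)
    (p : Hom (dual M) (dual N)) : ((ev N).comp (transpose hM p)).dual = p := by
  ext S a : 3
  refine DualElt.ext' fun T f x => ?_
  rw [DualElt.app_eq_pairing, DualElt.app_eq_pairing, ← Hom.naturality, ← Hom.naturality]
  rw [pairing_dual]
  refine (pairing_transpose hM p _ _).trans ?_
  exact pairing_ev _ _

theorem inv_ev_dual {M : ModFunctor.{u, w} R} (hM : IsReflexive M) :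
    ((ev M).inv hM).dual = ev (dual M) := by
  ext S a : 3
  refine DualElt.ext' fun T f x => ?_
  obtain ⟨y, rfl⟩ := (hM T).2 x
  rw [DualElt.app_eq_pairing, DualElt.app_eq_pairing, ← Hom.naturality, ← Hom.naturality,
    pairing_dual]
  refine (congrArg (pairing M T · _) ((ev M).inv_app hM T y)).trans ?_
  exact ((pairing_ev _ _).trans (pairing_ev _ _)).symm

/-- The transpose of `ev M` is a left inverse of the isomorphism `ev (dual M)`, along which the
algebra structure was transported. -/
theorem ev_dual_isAlgHom {M : ModFunctor.{u, w} R} (hM : IsReflexive M) (d : AlgStruct (dual M)) :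
    IsAlgHom (d.transport (ev (dual M)) hM.dual) d (ev M).dual := by
  have h := d.isAlgHom_transport (ev _) hM.dual
  refine ⟨fun S x y => ?_, fun S => ?_⟩
  · obtain ⟨x, rfl⟩ := (hM.dual S).2 x
    obtain ⟨y, rfl⟩ := (hM.dual S).2 y
    rw [← h.1, ev_dual_comp, ev_dual_comp, ev_dual_comp]
  · rw [← h.2, ev_dual_comp]

theorem inv_ev_dual_isAlgHom {M : ModFunctor.{u, w} R} (hM : IsReflexive M)
    (d : AlgStruct (dual M)) :
    IsAlgHom d (d.transport (ev (dual M)) hM.dual) ((ev M).inv hM).dual := by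
  rw [inv_ev_dual]
  exact d.isAlgHom_transport _ _

namespace BiAlgFunctor

/-- The isomorphism of functors of bialgebras `B ≅ B^**`. -/
def evIso (B : BiAlgFunctor R) : B ≅ B.dual.dual where
  hom := ⟨ev B.carrier, B.alg.isAlgHom_transport _ _, ev_dual_isAlgHom B.reflexive B.dualAlg⟩
  inv := ⟨(ev B.carrier).inv B.reflexive, (B.alg.isAlgHom_transport _ _).inv B.reflexive,
    inv_ev_dual_isAlgHom B.reflexive B.dualAlg⟩
  hom_inv_id := Hom.ext <| ReflexiveFunctors.Hom.ext <| funext fun S => LinearMap.ext fun x =>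
    (ev B.carrier).inv_app B.reflexive S x
  inv_hom_id := Hom.ext <| ReflexiveFunctors.Hom.ext <| funext fun S => LinearMap.ext fun x =>
    (ev B.carrier).app_inv B.reflexive S x

instance : (dualFunctor R).Faithful where
  map_injective {B _} _ _ h := Quiver.Hom.unop_inj <| Hom.ext <|
    ReflexiveFunctors.Hom.dual_injective B.unop.reflexive (congrArg Hom.hom h)

instance : (dualFunctor R).Full where
  map_surjective {B B'} p := by
    let k : ReflexiveFunctors.Hom B'.unop.carrier B.unop.carrier :=
      (ev _).comp (transpose B.unop.reflexive p.hom)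
    have hk : k.dual = p.hom := dual_transpose B.unop.reflexive p.hom
    refine ⟨Quiver.Hom.op ⟨k, ?_, ?_⟩, Hom.ext hk⟩
    · exact (B'.unop.alg.isAlgHom_transport _ _).comp (p.dual_isAlgHom.comp
        ((B.unop.alg.isAlgHom_transport _ _).inv B.unop.reflexive))
    · rw [hk]
      exact p.isAlgHom

end BiAlgFunctor

end ReflexiveFunctors
end

/-- Stability under duality is the witness `h` that lets the functor be lifted to the full
subcategory. Fullness and faithfulness are inherited from `dualFunctor`, and `evIso` shows that each
object is isomorphic to the dual of its dual. -/
theorem mainTheorem1 (R : Type u) [CommRing R] :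
    ∃ h : ∀ B : (ReflexiveFunctors.BiAlgFunctor.fBialg R).FullSubcategoryᵒᵖ,
        ReflexiveFunctors.BiAlgFunctor.fBialg R
          (((ReflexiveFunctors.BiAlgFunctor.fBialg R).ι.op ⋙
            ReflexiveFunctors.BiAlgFunctor.dualFunctor R).obj B),
      ((ReflexiveFunctors.BiAlgFunctor.fBialg R).lift
        ((ReflexiveFunctors.BiAlgFunctor.fBialg R).ι.op ⋙
          ReflexiveFunctors.BiAlgFunctor.dualFunctor R) h).IsEquivalence := by
  have h (B : (ReflexiveFunctors.BiAlgFunctor.fBialg R).FullSubcategoryᵒᵖ) :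
      ReflexiveFunctors.BiAlgFunctor.fBialg R
        (((ReflexiveFunctors.BiAlgFunctor.fBialg R).ι.op ⋙
          ReflexiveFunctors.BiAlgFunctor.dualFunctor R).obj B) := B.unop.property.dual
  refine ⟨h, { essSurj := ⟨fun B => ⟨Opposite.op ⟨B.obj.dual, B.property.dual⟩, ⟨?_⟩⟩⟩ }⟩
  exact (ReflexiveFunctors.BiAlgFunctor.fBialg R).isoMk B.obj.evIso.symm
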